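/- Let $\mathcal H$ and $V$ be separable Hilbert spaces and let $L:D(L)\subset\mathcal H\to\mathcal H$ be the infinitesimal generator of a $C_0$-semigroup $(T(t))_{t\ge 0}$ on $\mathcal H$. Let $(\mathcal H_N)_{N\ge1}$ be finite-dimensional subspaces of $\mathcal H$ with $\mathcal H_N\subset D(L)$, with orthogonal projectors $\Pi_N:\mathcal H\to\mathcal H_N$ such that $\|\Pi_Nx-x\|\to0$ for every $x\in\mathcal H$, and put $L_N:=\Pi_NL\Pi_N$. Assume that there are $M\ge1$, $\omega\ge0$ such that $\|T(t)\|\le Me^{\omega t}$ for $t\ge0$ and, for every $N$, the flow $e^{L_Nt}$ on $\mathcal H_N$ extends to a $C_0$-semigroup $T_N(t)$ on $\mathcal H$ with $\|T_N(t)\|\le Me^{\omega t}$ for $t\ge0$; and that $\|L_N\varphi-L\varphi\|\to0$ as $N\to\infty$ for every $\varphi\in D(L)$. Call a map between normed spaces locally Lipschitz if it is Lipschitz on every ball centered at the origin. Let $F:\mathcal H\to\mathcal H$ be locally Lipschitz and let $\mathfrak C:V\to\mathcal H$ be continuous with $\mathfrak C(0)=0$. Let $T>0$, $1\le q<\infty$,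 let $U\subset V$ be compact and convex, and let $$\mathcal U_{ad}=\{u\in L^q(0,T;V): u(s)\in U\text{ for a.e. }s\in[0,T]\},\qquad \mathcal U_{ad}[t,T]=\{u|_{[t,T]}:u\in\mathcal U_{ad}\}.$$ For $t\in[0,T]$, $x\in\mathcal H$, $u\in\mathcal U_{ad}[t,T]$, let $y_{t,x}(\cdot;u)\in C([t,T],\mathcal H)$ denote the mild solution of $y'=Ly+F(y)+\mathfrak C(u)$, $y(t)=x$, that is, $$y(s)=T(s-t)x+\int_t^sT(s-r)F(y(r))\,dr+\int_t^sT(s-r)\mathfrak C(u(r))\,dr,\qquad s\in[t,T],$$ and, for $x_N\in\mathcal H_N$, let $y^N_{t,x_N}(\cdot;u)\in C([t,T],\mathcal H)$ denote the solution of the Galerkin equation $y_N'=L_Ny_N+\Pi_NF(y_N)+\Pi_N\mathfrak C(u)$, $y_N(t)=x_N$, understood in integrated form. Assume that for all $x\in\mathcal H$, $u\in\mathcal U_{ad}$ and $N\ge1$ the solutions $y_{0,x}(\cdot;u)$ and $y^N_{0,\Pi_Nx}(\cdot;u)$ on $[0,T]$ exist and are unique; that for every $x\in\mathcal H$ there is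 a constant $R$ with $\|y_{0,x}(s;u)\|\le R$ and $\|y^N_{0,\Pi_Nx}(s;u)\|\le R$ for all $s\in[0,T]$, $u\in\mathcal U_{ad}$, $N\ge1$; and that for every $x\in\mathcal H$ $$\lim_{N\to\infty}\ \sup_{u\in\mathcal U_{ad}}\ \sup_{s\in[0,T]}\|(\mathrm{Id}-\Pi_N)y_{0,x}(s;u)\|=0.$$ Let $\mathcal G:\mathcal H\to[0,\infty)$ be locally Lipschitz, let $\mathcal E:V\to[0,\infty)$ be continuous, and define, for $t\in[0,T)$, $$v(t,x)=\inf_{u\in\mathcal U_{ad}[t,T]}\int_t^T\big[\mathcal G(y_{t,x}(s;u))+\mathcal E(u(s))\big]ds,\qquad v_N(t,x_N)=\inf_{u\in\mathcal U_{ad}[t,T]}\int_t^T\big[\mathcal G(y^N_{t,x_N}(s;u))+\mathcal E(u(s))\big]ds$$ for $x\in\mathcal H$, $x_N\in\mathcal H_N$, and $v(T,\cdot)=0$, $v_N(T,\cdot)=0$. (By time-invariance, the assumptions above guarantee that the solutions started at time $t$ exist and are unique.) Assume that for every $t\in[0,T)$ the infimum defining $v(t,x)$ is attained for every $x\in\mathcal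 H$ and the infimum defining $v_N(t,x_N)$ is attained for every $N\ge1$ and $x_N\in\mathcal H_N$. Then, for every $x\in\mathcal H$, $$\lim_{N\to\infty}\ \sup_{t\in[0,T]}|v_N(t,\Pi_Nx)-v(t,x)|=0.$$ -/

import Mathlib

open MeasureTheory Set Filter Topology
open scoped ENNReal

noncomputable section

namespace GalerkinControl

/-- Strongly continuous (`C₀`) semigroup of bounded operators `S t`, `t ≥ 0`.
The values `S t` for `t < 0` are irrelevant and never used. -/
structure IsC0Semigroup {H : Type*} [NormedAddCommGroup H] [NormedSpace ℝ H]
    (S : ℝ → H →L[ℝ] H) : Prop where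
  map_zero : S 0 = ContinuousLinearMap.id ℝ H
  map_add : ∀ s t : ℝ, 0 ≤ s → 0 ≤ t → S (s + t) = (S s).comp (S t)
  tendsto_zero : ∀ x : H, Tendsto (fun t : ℝ => S t x) (𝓝[>] 0) (𝓝 x)

/-- The (possibly unbounded) operator `L : D(L) ⊆ H → H` is the infinitesimal generator of the
semigroup `S`: `x ∈ D(L)` and `L x = y` iff `(S(t) x - x) / t → y` as `t → 0⁺`. -/
def IsInfinitesimalGenerator {H : Type*} [NormedAddCommGroup H] [NormedSpace ℝ H]
    (L : H →ₗ.[ℝ] H) (S : ℝ → H →L[ℝ] H) : Prop :=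
  ∀ x y : H, (x, y) ∈ L.graph ↔
    Tendsto (fun t : ℝ => t⁻¹ • (S t x - x)) (𝓝[>] 0) (𝓝 y)

/-- Lipschitz on every ball centered at the origin. -/
def LipschitzOnBalls {W₁ W₂ : Type*} [NormedAddCommGroup W₁] [NormedAddCommGroup W₂]
    (f : W₁ → W₂) : Prop :=
  ∀ r : ℝ, 0 < r → ∃ K : ℝ, 0 < K ∧
    ∀ y₁ ∈ Metric.closedBall (0 : W₁) r, ∀ y₂ ∈ Metric.closedBall (0 : W₁) r,
      ‖f y₁ - f y₂‖ ≤ K * ‖y₁ - y₂‖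

section Galerkin

variable {H : Type*} [NormedAddCommGroup H] [InnerProductSpace ℝ H]

/-- The Galerkin operator `Π_K L Π_K`, for a finite-dimensional subspace `K ⊆ D(L)` with
orthogonal projector `Π_K`; it is everywhere defined and bounded. -/
def galerkinOperator (L : H →ₗ.[ℝ] H) (K : Submodule ℝ H) [FiniteDimensional ℝ K]
    (hK : K ≤ L.domain) : H →L[ℝ] H :=
  (K.starProjection).comp
    ((LinearMap.toContinuousLinearMap (L.toFun.comp (Submodule.inclusion hK))).comp
      K.orthogonalProjectionOnto)

end Galerkin

section Solutions

variable {H V : Type*} [NormedAddCommGroup H] [InnerProductSpace ℝ H]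

/-- `y` is a mild solution over `[t₀, T]` of `y' = L y + F(y) + C(u)`, `y(t₀) = x`, where `S` is
the semigroup generated by `L`. -/
def IsMildSolution (S : ℝ → H →L[ℝ] H) (F : H → H) (C : V → H) (T : ℝ)
    (t₀ : ℝ) (x : H) (u : ℝ → V) (y : ℝ → H) : Prop :=
  ContinuousOn y (Icc t₀ T) ∧
    ∀ s ∈ Icc t₀ T,
      y s = S (s - t₀) x + (∫ r in t₀..s, S (s - r) (F (y r)))
        + ∫ r in t₀..s, S (s - r) (C (u r))

/-- `y` is a solution over `[t₀, T]` of the Galerkin equation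
`y' = L_K y + Π_K F(y) + Π_K C(u)`, `y(t₀) = ξ` with `ξ ∈ K`. As the control is only measurable
in time, the equation is understood in integrated form. (Such a `y` takes its values in `K`.) -/
def IsGalerkinSolution (L : H →ₗ.[ℝ] H) (K : Submodule ℝ H) [FiniteDimensional ℝ K]
    (hK : K ≤ L.domain) (F : H → H) (C : V → H) (T : ℝ)
    (t₀ : ℝ) (ξ : H) (u : ℝ → V) (y : ℝ → H) : Prop :=
  ContinuousOn y (Icc t₀ T) ∧
    ∀ s ∈ Icc t₀ T,
      y s = ξ + ∫ r in t₀..s, (galerkinOperator L K hK (y r)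
        + K.starProjection (F (y r)) + K.starProjection (C (u r)))

end Solutions

section Control

variable {H V : Type*} [NormedAddCommGroup V]

/-- The set of admissible controls: (representatives of) functions in `L^q(0,T;V)` with values in
`U` almost everywhere on `[0,T]`. -/
def admissibleControls (q : ℝ≥0∞) (U : Set V) (T : ℝ) : Set (ℝ → V) :=
  {u | MemLp u q (volume.restrict (Icc 0 T)) ∧ ∀ᵐ s ∂(volume.restrict (Icc 0 T)), u s ∈ U}

/-- Restrictions to `[t,T]` of admissible controls (values outside `[t,T]` are irrelevant). -/
def admissibleControlsFrom (q : ℝ≥0∞) (U : Set V) (T t : ℝ) : Set (ℝ → V) :=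
  {w | ∃ u ∈ admissibleControls q U T, EqOn w u (Icc t T)}

/-- Cost accumulated over `[t,T]` by a control-state pair `(u, y)`. -/
def cost (G : H → ℝ) (E : V → ℝ) (T t : ℝ) (p : (ℝ → V) × (ℝ → H)) : ℝ :=
  ∫ s in t..T, (G (p.2 s) + E (p.1 s))

/-- Pairs `(u, y)` of an admissible control `u` on `[t,T]` and a corresponding state `y`, emanating
from `x` at time `t`; `sol t x u y` says that `y` solves the state equation. -/
def admissiblePairs (q : ℝ≥0∞) (U : Set V) (T : ℝ)
    (sol : ℝ → H → (ℝ → V) → (ℝ → H) → Prop) (t : ℝ) (x : H) : Set ((ℝ → V) × (ℝ → H)) :=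
  {p | p.1 ∈ admissibleControlsFrom q U T t ∧ sol t x p.1 p.2}

/-- The value function of the optimal control problem with state equation `sol`: the infimum of the
cost for `t < T`, and zero at the final time. -/
def valueFunction (q : ℝ≥0∞) (U : Set V) (G : H → ℝ) (E : V → ℝ) (T : ℝ)
    (sol : ℝ → H → (ℝ → V) → (ℝ → H) → Prop) (t : ℝ) (x : H) : ℝ :=
  open Classical in
  if t < T then sInf (cost G E T t '' admissiblePairs q U T sol t x) else 0

/-- The optimal control problem started from `x` at time `t` possesses a minimizer. -/
def HasMinimizer (q : ℝ≥0∞) (U : Set V) (G : H → ℝ) (E : V → ℝ) (T : ℝ)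
    (sol : ℝ → H → (ℝ → V) → (ℝ → H) → Prop) (t : ℝ) (x : H) : Prop :=
  ∃ p ∈ admissiblePairs q U T sol t x, IsMinOn (cost G E T t) (admissiblePairs q U T sol t x) p

end Control

end GalerkinControl

end

open GalerkinControl

/-!
Two ingredients carry the convergence of the value functions: the Galerkin states converge to the
states of the limit equation *uniformly in the control*, and the problem is time invariant.

For the linear part, the Galerkin semigroups `e^{t L_N} Π_N` converge strongly to `S t`, uniformly
for `t` in bounded intervals (`eventually_norm_galerkinSemigroup_sub_le`, a Trotter–Kato theorem).
Instead of resolvents, its proof uses the averages `J z = ∫₀ᵃ S(τ) z dτ`. They lie in the domain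
of the generator, with `L J = S a - 1` bounded; hence the bounded operators `L_N J` converge
pointwise by consistency, are uniformly bounded by the Banach–Steinhaus theorem, and therefore
converge uniformly on the compact orbit `{S r z | 0 ≤ r ≤ T}`. Differentiating `r ↦ e^{(t-r) L_N}
Π_N S(r) J z` turns this into convergence of the semigroups at `J z`, and the vectors `a⁻¹ J z`
approximate `z` as `a → 0`.

For the states, Duhamel's formula (`eq_exp_apply_add_integral_of_eq_add_integral`) presents a
Galerkin solution as a mild solution for the propagator `e^{t L_N} Π_N`. Two mild solutions for
different propagators are compared by Grönwall's inequality (`IsMildSolution.norm_sub_le`); the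
error is controlled by the distance of the propagators on the initial state, on the control
forces, and on the values of the nonlinearity along the limit solutions. The vanishing residual
energy is what makes the last set relatively compact: the states, over all times and all controls,
are bounded and uniformly close to finite-dimensional subspaces, hence totally bounded. On compact
sets strong convergence of equibounded operators is uniform, which gives
`eventually_norm_isGalerkinSolution_sub_isMildSolution_le`.

Finally, a control on `[t, T]` is translated to `[0, T - t]` and extended to `[0, T]`, so the
estimate for initial time `0` applies to every initial time. States driven by the same control
then have nearly the same costs, and so the infima are close, uniformly in `t`.
-/

namespace GalerkinControl

/-! ### Grönwall's inequality, Fubini's theorem on a triangle, and Duhamel's formula -/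

/-- Grönwall's inequality in integral form. -/
theorem le_mul_exp_of_le_add_mul_integral {d : ℝ → ℝ} {a b ε k : ℝ} (hk : 0 ≤ k)
    (hd : ContinuousOn d (Icc a b)) (hd0 : ∀ s ∈ Icc a b, 0 ≤ d s)
    (h : ∀ s ∈ Icc a b, d s ≤ ε + k * ∫ r in a..s, d r) :
    ∀ s ∈ Icc a b, d s ≤ ε * Real.exp (k * (s - a)) := by
  intro s hs
  have hab : a ≤ b := hs.1.trans hs.2
  set D : ℝ → ℝ := IccExtend hab ((Icc a b).domRestrict d) with hD
  have hDc : Continuous D := (continuousOn_iff_continuous_domRestrict.1 hd).Icc_extend'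
  have hDd : ∀ r ∈ Icc a b, D r = d r := fun r hr => by
    rw [hD, IccExtend_of_mem _ _ hr]; rfl
  have hDi : ∀ r ∈ Icc a b, ∫ τ in a..r, d τ = ∫ τ in a..r, D τ := fun r hr => by
    refine intervalIntegral.integral_congr fun τ hτ => ?_
    rw [uIcc_of_le hr.1] at hτ
    exact (hDd τ ⟨hτ.1, hτ.2.trans hr.2⟩).symm
  set g : ℝ → ℝ := fun r => ε + k * ∫ τ in a..r, D τ with hg
  have hg' : ∀ r, HasDerivAt g (k * D r) r := fun r =>
    ((hDc.integral_hasStrictDerivAt a r).hasDerivAt.const_mul k).const_add ε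
  have hdg : ∀ r ∈ Icc a b, d r ≤ g r := fun r hr => by
    have := h r hr
    rwa [hDi r hr] at this
  have hgb := norm_le_gronwallBound_of_norm_deriv_right_le (f := g) (f' := fun r => k * D r)
    (δ := ε) (K := k) (ε := 0) (a := a) (b := b)
    (fun r _ => (hg' r).continuousAt.continuousWithinAt)
    (fun r _ => (hg' r).hasDerivWithinAt)
    (by
      have h1 := hdg a ⟨le_rfl, hab⟩
      have h2 := hd0 a ⟨le_rfl, hab⟩
      simp only [hg, intervalIntegral.integral_same, mul_zero, add_zero] at h1 ⊢
      rw [Real.norm_of_nonneg (h2.trans h1)])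
    (fun r hr => by
      have hr' := Ico_subset_Icc_self hr
      rw [hDd r hr', add_zero, Real.norm_of_nonneg (mul_nonneg hk (hd0 r hr'))]
      exact mul_le_mul_of_nonneg_left ((hdg r hr').trans (Real.le_norm_self _)) hk) s hs
  rw [gronwallBound_ε0] at hgb
  exact ((hdg s hs).trans (Real.le_norm_self _)).trans hgb

section Duhamel

variable {H : Type*} [NormedAddCommGroup H] [NormedSpace ℝ H] [CompleteSpace H]

/-- Fubini's theorem on the triangle `a < τ ≤ r ≤ s`. -/
theorem integral_apply_integral_eq_integral_integral_apply {Ψ : ℝ → H →L[ℝ] H}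
    (hΨ : Continuous Ψ) {k : ℝ → H} {a s : ℝ} (hs : a ≤ s)
    (hk : IntervalIntegrable k volume a s) :
    ∫ r in a..s, Ψ r (∫ τ in a..r, k τ)
      = ∫ τ in a..s, (∫ r in τ..s, Ψ r) (k τ) := by
  set μ : Measure ℝ := volume.restrict (Ioc a s) with hμ
  have hkμ : Integrable k μ := (intervalIntegrable_iff_integrableOn_Ioc_of_le hs).1 hk
  obtain ⟨c, hc⟩ := (isCompact_Icc (a := a) (b := s)).exists_bound_of_continuousOn
    hΨ.continuousOn
  set f : ℝ → ℝ → H := fun r τ => (Iic r).indicator (fun τ => Ψ r (k τ)) τ with hf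
  have hf' : Function.uncurry f
      = {p : ℝ × ℝ | p.2 ≤ p.1}.indicator (fun p => Ψ p.1 (k p.2)) := by
    ext ⟨r, τ⟩
    simp only [Function.uncurry_apply_pair, hf, indicator_apply, mem_Iic, mem_ofPred_eq]
  have hint : Integrable (Function.uncurry f) (μ.prod μ) := by
    rw [hf']
    refine Integrable.indicator ?_ (measurableSet_le measurable_snd measurable_fst)
    refine Integrable.mono' ((hkμ.comp_snd μ).norm.const_mul c) ?_ ?_
    · exact (ContinuousLinearMap.apply ℝ H).flip.aestronglyMeasurable_comp₂
        (hΨ.comp continuous_fst).aestronglyMeasurable (hkμ.comp_snd μ).aestronglyMeasurable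
    · have h1 : ∀ᵐ p ∂(μ.prod μ), p.1 ∈ Ioc a s :=
        Measure.quasiMeasurePreserving_fst.ae (ae_restrict_mem measurableSet_Ioc)
      filter_upwards [h1] with p hp
      exact (Ψ p.1).le_of_opNorm_le (hc _ (Ioc_subset_Icc_self hp)) _
  have hswap := integral_integral_swap hint
  rw [intervalIntegral.integral_of_le hs, intervalIntegral.integral_of_le hs]
  refine Eq.trans ?_ (hswap.trans ?_)
  · refine setIntegral_congr_fun measurableSet_Ioc fun r hr => ?_
    have hkr : IntervalIntegrable k volume a r :=
      hk.mono_set (by rw [uIcc_of_le hr.1.le, uIcc_of_le hs]; exact Icc_subset_Icc_right hr.2)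
    simp only [hf]
    rw [integral_indicator measurableSet_Iic, hμ, Measure.restrict_restrict measurableSet_Iic,
      show Iic r ∩ Ioc a s = Ioc a r by ext; grind,
      ← intervalIntegral.integral_of_le hr.1.le]
    exact ((Ψ r).intervalIntegral_comp_comm hkr).symm
  · refine setIntegral_congr_fun measurableSet_Ioc fun τ hτ => ?_
    have h1 : (fun r => f r τ) = (Ici τ).indicator (fun r => Ψ r (k τ)) := by
      ext r
      simp only [hf, indicator_apply, mem_Iic, mem_Ici]
    simp only [h1]
    rw [integral_indicator measurableSet_Ici, hμ, Measure.restrict_restrict measurableSet_Ici,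
      show Ici τ ∩ Ioc a s = Icc τ s by ext; grind, integral_Icc_eq_integral_Ioc,
      ← intervalIntegral.integral_of_le hτ.2]
    exact (ContinuousLinearMap.intervalIntegral_apply (hΨ.intervalIntegrable _ _) _).symm

/-- Duhamel's formula for `y' = A y + g` with `A` bounded and `g` merely integrable. -/
theorem eq_exp_apply_add_integral_of_eq_add_integral (A : H →L[ℝ] H) {y g : ℝ → H} {ξ : H}
    {a s : ℝ} (hs : a ≤ s) (hy : ContinuousOn y (Icc a s)) (hg : IntervalIntegrable g volume a s)
    (h : ∀ r ∈ Icc a s, y r = ξ + ∫ τ in a..r, (A (y τ) + g τ)) :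
    y s = NormedSpace.exp ((s - a) • A) ξ
      + ∫ r in a..s, NormedSpace.exp ((s - r) • A) (g r) := by
  set Φ : ℝ → H →L[ℝ] H := fun r => NormedSpace.exp ((s - r) • A) with hΦ
  set Ψ : ℝ → H →L[ℝ] H := fun r => Φ r * A with hΨ
  have hΦ' : ∀ r, HasDerivAt Φ (-Ψ r) r := fun r => by
    have h1 := (hasDerivAt_exp_smul_const (𝕂 := ℝ) A (s - r)).scomp r
      ((hasDerivAt_id r).const_sub s)
    simpa [hΨ, hΦ, Function.comp_def] using h1
  have hΦc : Continuous Φ := continuous_iff_continuousAt.2 fun r => (hΦ' r).continuousAt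
  have hΨc : Continuous Ψ := hΦc.mul continuous_const
  have hΨi : ∀ τ, ∫ r in τ..s, Ψ r = Φ τ - 1 := fun τ => by
    have h1 := intervalIntegral.integral_eq_sub_of_hasDerivAt (a := τ) (b := s)
      (fun r _ => (hΦ' r).neg) (by simpa using hΨc.intervalIntegrable _ _)
    simp only [neg_neg] at h1
    rw [h1]
    simp only [hΦ, Pi.neg_apply, sub_self, zero_smul, NormedSpace.exp_zero]
    abel
  set k : ℝ → H := fun τ => A (y τ) + g τ with hk
  have hAy : IntervalIntegrable (fun τ => A (y τ)) volume a s :=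
    (A.continuous.comp_continuousOn (by rwa [uIcc_of_le hs])).intervalIntegrable
  have hki : IntervalIntegrable k volume a s := hAy.add hg
  have hfub := integral_apply_integral_eq_integral_integral_apply hΨc hs hki
  have hΦi : ∀ {f : ℝ → H}, IntervalIntegrable f volume a s →
      IntervalIntegrable (fun r => Φ r (f r)) volume a s := fun {f} hf => by
    rw [intervalIntegrable_iff_integrableOn_Ioc_of_le hs] at hf ⊢
    obtain ⟨c, hc⟩ := (isCompact_Icc (a := a) (b := s)).exists_bound_of_continuousOn
      hΦc.continuousOn
    refine Integrable.mono' (hf.norm.const_mul c)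
      ((ContinuousLinearMap.apply ℝ H).flip.aestronglyMeasurable_comp₂
        hΦc.aestronglyMeasurable hf.aestronglyMeasurable) ?_
    filter_upwards [ae_restrict_mem measurableSet_Ioc] with p hp
    exact (Φ p).le_of_opNorm_le (hc _ (Ioc_subset_Icc_self hp)) _
  have hΨy : IntervalIntegrable (fun r => Ψ r (y r)) volume a s := hΦi hAy
  have e1 : ∫ r in a..s, Ψ r (∫ τ in a..r, k τ)
      = (∫ r in a..s, Ψ r (y r)) - (Φ a ξ - ξ) := by
    have : ∫ r in a..s, Ψ r ξ = Φ a ξ - ξ := by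
      rw [← ContinuousLinearMap.intervalIntegral_apply (hΨc.intervalIntegrable _ _), hΨi]
      simp
    rw [← this, ← intervalIntegral.integral_sub hΨy
      ((hΨc.clm_apply continuous_const).intervalIntegrable _ _)]
    refine intervalIntegral.integral_congr fun r hr => ?_
    rw [uIcc_of_le hs] at hr
    rw [← map_sub, h r hr, add_sub_cancel_left]
  have e2 : ∫ τ in a..s, (∫ r in τ..s, Ψ r) (k τ)
      = (∫ r in a..s, Ψ r (y r)) + (∫ r in a..s, Φ r (g r)) - (y s - ξ) := by
    rw [h s ⟨hs, le_rfl⟩, add_sub_cancel_left, ← intervalIntegral.integral_add hΨy (hΦi hg),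
      ← intervalIntegral.integral_sub (hΨy.add (hΦi hg)) hki]
    refine intervalIntegral.integral_congr fun r _ => ?_
    rw [hΨi]
    simp only [hk, hΨ, sub_apply, map_add, mul_apply_eq_comp, one_apply_eq_self]
    abel
  rw [e1, e2] at hfub
  have h0 : Φ a = NormedSpace.exp ((s - a) • A) := rfl
  rw [← h0]
  have := sub_eq_zero.2 hfub
  rw [← sub_eq_zero, ← this]
  abel

end Duhamel

/-! ### Operators converging on totally bounded sets -/

section Approximation

variable {X Y : Type*} [NormedAddCommGroup X] [NormedSpace ℝ X] [NormedAddCommGroup Y]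
  [NormedSpace ℝ Y]

/-- Uniformly bounded families of operators that converge at each point, uniformly in the
parameter, converge uniformly on totally bounded sets. -/
theorem eventually_forall_mem_norm_sub_le_of_totallyBounded {ι : Type*} {I : Set ι}
    {A : ℕ → ι → X →L[ℝ] Y} {B : ι → X →L[ℝ] Y} {c : ℝ}
    (hA : ∀ N, ∀ i ∈ I, ‖A N i‖ ≤ c) (hB : ∀ i ∈ I, ‖B i‖ ≤ c)
    (h : ∀ z, ∀ ε > 0, ∀ᶠ N in atTop, ∀ i ∈ I, ‖A N i z - B i z‖ ≤ ε)
    {Q : Set X} (hQ : TotallyBounded Q) {ε : ℝ} (hε : 0 < ε) :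
    ∀ᶠ N in atTop, ∀ i ∈ I, ∀ z ∈ Q, ‖A N i z - B i z‖ ≤ ε := by
  obtain ⟨η, hη, hηε⟩ : ∃ η > 0, 2 * c * η ≤ ε / 2 := by
    refine ⟨ε / 4 / (|c| + 1), by positivity, ?_⟩
    rw [mul_div_assoc', div_le_iff₀ (by positivity)]
    nlinarith [le_abs_self c, abs_nonneg c]
  obtain ⟨t, ht, hQt⟩ := Metric.totallyBounded_iff.1 hQ η hη
  filter_upwards [(eventually_all_finite ht).2 fun z _ => h z (ε / 2) (half_pos hε)] with N hN
  intro i hi z hz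
  obtain ⟨w, hw, hzw⟩ := mem_iUnion₂.1 (hQt hz)
  have hzw' : ‖z - w‖ ≤ η := (mem_ball_iff_norm.1 hzw).le
  have hc : 0 ≤ c := (norm_nonneg _).trans (hB i hi)
  have e : A N i z - B i z = (A N i w - B i w) + (A N i (z - w) - B i (z - w)) := by
    simp only [map_sub]; abel
  calc ‖A N i z - B i z‖ ≤ ‖A N i w - B i w‖ + (‖A N i (z - w)‖ + ‖B i (z - w)‖) := by
        rw [e]; exact (norm_add_le _ _).trans (by gcongr; exact norm_sub_le _ _)
    _ ≤ ε / 2 + (c * η + c * η) := by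
        gcongr
        · exact hN w hw i hi
        · exact (A N i).le_of_opNorm_le_of_le (hA N i hi) hzw'
        · exact (B i).le_of_opNorm_le_of_le (hB i hi) hzw'
    _ ≤ ε := by linarith

end Approximation

/-! ### Continuity of locally Lipschitz maps -/

theorem LipschitzOnBalls.continuous {W₁ W₂ : Type*} [NormedAddCommGroup W₁]
    [NormedAddCommGroup W₂] {f : W₁ → W₂} (hf : LipschitzOnBalls f) : Continuous f := by
  rw [continuous_iff_continuousAt]
  intro x
  obtain ⟨k, hk, h⟩ := hf (‖x‖ + 1) (by positivity)
  have hl : LipschitzOnWith k.toNNReal f (Metric.closedBall 0 (‖x‖ + 1)) := by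
    refine LipschitzOnWith.of_dist_le_mul fun a ha b hb => ?_
    rw [dist_eq_norm, dist_eq_norm, Real.coe_toNNReal _ hk.le]
    exact h a ha b hb
  refine hl.continuousOn.continuousAt ?_
  refine mem_of_superset (Metric.ball_mem_nhds x one_pos) fun z hz => ?_
  rw [mem_closedBall_zero_iff]
  have h1 : ‖z - x‖ < 1 := mem_ball_iff_norm.1 hz
  have h2 := norm_sub_norm_le z x
  linarith

/-! ### Strongly continuous semigroups -/

section Semigroup

variable {H : Type*} [NormedAddCommGroup H] [NormedSpace ℝ H]

theorem mul_exp_le_mul_exp {M ω t τ : ℝ} (hM : 1 ≤ M) (hω : 0 ≤ ω) (h : t ≤ τ) :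
    M * Real.exp (ω * t) ≤ M * Real.exp (ω * τ) := by
  have : (0 : ℝ) ≤ M := zero_le_one.trans hM
  gcongr

/-- A family of operators with continuous orbits and locally bounded norms is jointly continuous. -/
theorem continuous_apply_of_continuous_orbits {W : ℝ → H →L[ℝ] H}
    (hW : ∀ z, Continuous fun t => W t z) {b : ℝ → ℝ} (hb : Continuous b)
    (hWb : ∀ t, ‖W t‖ ≤ b t) : Continuous fun p : ℝ × H => W p.1 p.2 := by
  rw [continuous_iff_continuousAt]
  rintro ⟨t₀, z₀⟩
  rw [ContinuousAt, tendsto_iff_norm_sub_tendsto_zero]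
  have h1 : Tendsto (fun p : ℝ × H => b p.1 * ‖p.2 - z₀‖ + ‖W p.1 z₀ - W t₀ z₀‖)
      (𝓝 (t₀, z₀)) (𝓝 0) := by
    have hc : Continuous fun p : ℝ × H => b p.1 * ‖p.2 - z₀‖ + ‖W p.1 z₀ - W t₀ z₀‖ := by
      have := hW z₀
      fun_prop
    simpa using hc.tendsto (t₀, z₀)
  refine squeeze_zero (fun _ => norm_nonneg _) (fun p => ?_) h1
  have e : W p.1 p.2 - W t₀ z₀ = W p.1 (p.2 - z₀) + (W p.1 z₀ - W t₀ z₀) := by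
    rw [map_sub]; abel
  simp only [e]
  exact (norm_add_le _ _).trans (by gcongr; exact (W p.1).le_of_opNorm_le (hWb _) _)

variable {S : ℝ → H →L[ℝ] H} {M ω : ℝ}

theorem IsC0Semigroup.continuous_orbit (hS : IsC0Semigroup S) (hM : 1 ≤ M) (hω : 0 ≤ ω)
    (hb : ∀ t : ℝ, 0 ≤ t → ‖S t‖ ≤ M * Real.exp (ω * t)) (z : H) :
    Continuous fun t : ℝ => S (max t 0) z := by
  have key : ∀ τ s t : ℝ, 0 ≤ s → s ≤ t → s ≤ τ →
      ‖S t z - S s z‖ ≤ M * Real.exp (ω * τ) * ‖S (t - s) z - z‖ := by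
    intro τ s t hs hst hsτ
    have h1 : S t z = S s (S (t - s) z) := by
      rw [← ContinuousLinearMap.comp_apply, ← hS.map_add s (t - s) hs (sub_nonneg.2 hst),
        add_sub_cancel]
    rw [h1, ← map_sub]
    exact (S s).le_of_opNorm_le ((hb s hs).trans (mul_exp_le_mul_exp hM hω hsτ)) _
  have hlim : Tendsto (fun t : ℝ => ‖S t z - z‖) (𝓝[≥] 0) (𝓝 0) := by
    rw [← tendsto_iff_norm_sub_tendsto_zero, ← Ioi_insert, nhdsWithin_insert, tendsto_sup]
    refine ⟨?_, hS.tendsto_zero z⟩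
    have : z = S 0 z := by simp [hS.map_zero]
    conv_rhs => rw [this]
    exact tendsto_pure_nhds _ _
  rw [continuous_iff_continuousAt]
  intro t₀
  rw [ContinuousAt, tendsto_iff_norm_sub_tendsto_zero]
  have h1 : Tendsto (fun t : ℝ => |max t 0 - max t₀ 0|) (𝓝 t₀) (𝓝[≥] 0) := by
    refine tendsto_nhdsWithin_iff.2 ⟨?_, Eventually.of_forall fun t => mem_Ici.2 (abs_nonneg _)⟩
    have hc : Continuous fun t : ℝ => |max t 0 - max t₀ 0| := by fun_prop
    simpa using hc.tendsto t₀
  have h2 := (hlim.comp h1).const_mul (M * Real.exp (ω * max t₀ 0))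
  rw [mul_zero] at h2
  refine squeeze_zero (fun _ => norm_nonneg _) (fun t => ?_) h2
  simp only [Function.comp_apply]
  rcases le_total (max t₀ 0) (max t 0) with h | h
  · rw [abs_of_nonneg (sub_nonneg.2 h)]
    exact key _ _ _ (le_max_right _ _) h le_rfl
  · rw [abs_of_nonpos (sub_nonpos.2 h), neg_sub, norm_sub_rev]
    exact key _ _ _ (le_max_right _ _) h h

theorem IsC0Semigroup.continuous_apply (hS : IsC0Semigroup S) (hM : 1 ≤ M) (hω : 0 ≤ ω)
    (hb : ∀ t : ℝ, 0 ≤ t → ‖S t‖ ≤ M * Real.exp (ω * t)) :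
    Continuous fun p : ℝ × H => S (max p.1 0) p.2 :=
  continuous_apply_of_continuous_orbits (W := fun t => S (max t 0))
    (hS.continuous_orbit hM hω hb) (b := fun t => M * Real.exp (ω * max t 0)) (by fun_prop)
    fun _ => hb _ (le_max_right _ _)

/-- The averaging operator `z ↦ ∫₀ᵃ S(τ) z dτ`, written with `S (max τ 0)` so that the integrand
is continuous on all of `ℝ`. -/
noncomputable def orbitIntegral (hS : IsC0Semigroup S) (hM : 1 ≤ M) (hω : 0 ≤ ω)
    (hb : ∀ t : ℝ, 0 ≤ t → ‖S t‖ ≤ M * Real.exp (ω * t)) (a : ℝ) : H →L[ℝ] H :=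
  LinearMap.mkContinuous
    { toFun := fun z => ∫ τ in (0 : ℝ)..a, S (max τ 0) z
      map_add' := fun x y => by
        simp only [map_add]
        exact intervalIntegral.integral_add
          ((hS.continuous_orbit hM hω hb x).intervalIntegrable _ _)
          ((hS.continuous_orbit hM hω hb y).intervalIntegrable _ _)
      map_smul' := fun c x => by
        simp only [map_smul, RingHom.id_apply]
        exact intervalIntegral.integral_smul _ _ }
    (M * Real.exp (ω * |a|) * |a|) fun z => by
      have h1 : ‖∫ τ in (0 : ℝ)..a, S (max τ 0) z‖ ≤ M * Real.exp (ω * |a|) * ‖z‖ * |a - 0| := by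
        refine intervalIntegral.norm_integral_le_of_norm_le_const fun τ hτ => ?_
        refine (S _).le_of_opNorm_le ((hb _ (le_max_right _ _)).trans
          (mul_exp_le_mul_exp hM hω (max_le ?_ (abs_nonneg _)))) _
        rcases mem_uIoc.1 hτ with h | h
        · exact h.2.trans (le_abs_self _)
        · exact h.2.trans (abs_nonneg _)
      rw [sub_zero] at h1
      exact h1.trans_eq (mul_right_comm _ _ _)

variable (hS : IsC0Semigroup S) (hM : 1 ≤ M) (hω : 0 ≤ ω)
    (hb : ∀ t : ℝ, 0 ≤ t → ‖S t‖ ≤ M * Real.exp (ω * t))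

theorem orbitIntegral_apply (a : ℝ) (z : H) :
    orbitIntegral hS hM hω hb a z = ∫ τ in (0 : ℝ)..a, S (max τ 0) z := rfl

theorem orbitIntegral_semigroup_apply {a r : ℝ} (ha : 0 ≤ a) (hr : 0 ≤ r) (z : H) :
    orbitIntegral hS hM hω hb a (S r z) = ∫ τ in r..r + a, S (max τ 0) z := by
  have h1 := intervalIntegral.integral_comp_add_right (a := 0) (b := a)
    (fun τ => S (max τ 0) z) r
  rw [zero_add, add_comm a r] at h1
  rw [orbitIntegral_apply, ← h1]
  refine intervalIntegral.integral_congr fun τ hτ => ?_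
  rw [uIcc_of_le ha] at hτ
  rw [max_eq_left hτ.1, max_eq_left (add_nonneg hτ.1 hr), hS.map_add τ r hτ.1 hr]
  rfl

variable [CompleteSpace H]

theorem semigroup_apply_orbitIntegral {a r : ℝ} (ha : 0 ≤ a) (hr : 0 ≤ r) (z : H) :
    S r (orbitIntegral hS hM hω hb a z) = ∫ τ in r..r + a, S (max τ 0) z := by
  rw [← orbitIntegral_semigroup_apply hS hM hω hb ha hr, orbitIntegral_apply, orbitIntegral_apply,
    ← (S r).intervalIntegral_comp_comm ((hS.continuous_orbit hM hω hb z).intervalIntegrable _ _)]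
  refine intervalIntegral.integral_congr fun τ hτ => ?_
  rw [uIcc_of_le ha] at hτ
  rw [max_eq_left hτ.1, ← ContinuousLinearMap.comp_apply, ← ContinuousLinearMap.comp_apply,
    ← hS.map_add _ _ hτ.1 hr, ← hS.map_add _ _ hr hτ.1, add_comm]

include hS hM hω hb in
theorem hasDerivAt_integral_orbit (a r : ℝ) (z : H) :
    HasDerivAt (fun r => ∫ τ in r..r + a, S (max τ 0) z)
      (S (max (r + a) 0) z - S (max r 0) z) r := by
  have hc := hS.continuous_orbit hM hω hb z
  have h1 : ∀ r, ∫ τ in r..r + a, S (max τ 0) z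
      = (∫ τ in (0 : ℝ)..r + a, S (max τ 0) z) - ∫ τ in (0 : ℝ)..r, S (max τ 0) z := fun r =>
    (intervalIntegral.integral_interval_sub_left (hc.intervalIntegrable _ _)
      (hc.intervalIntegrable _ _)).symm
  simp only [h1]
  refine HasDerivAt.sub ?_ (hc.integral_hasStrictDerivAt 0 r).hasDerivAt
  have h2 := (hc.integral_hasStrictDerivAt 0 (r + a)).hasDerivAt
  exact h2.comp_add_const r a

/-- The averages lie in the domain of the generator, which maps `∫₀ᵃ S(τ) z dτ` to `S(a) z - z`. -/
theorem orbitIntegral_mem_graph {L : H →ₗ.[ℝ] H} (hLS : IsInfinitesimalGenerator L S)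
    {a : ℝ} (ha : 0 ≤ a) (z : H) :
    (orbitIntegral hS hM hω hb a z, S a z - z) ∈ L.graph := by
  rw [hLS]
  have h1 := (hasDerivAt_integral_orbit hS hM hω hb a 0 z).hasDerivWithinAt (s := Ioi 0)
  rw [hasDerivWithinAt_iff_tendsto_slope' (by simp)] at h1
  simp only [zero_add, max_eq_left ha, max_self, hS.map_zero,
    ContinuousLinearMap.id_apply] at h1
  refine h1.congr' ?_
  filter_upwards [self_mem_nhdsWithin] with t ht
  rw [slope_def_module, sub_zero, semigroup_apply_orbitIntegral hS hM hω hb ha (le_of_lt ht),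
    zero_add]
  rfl

/-- The averages `a⁻¹ ∫₀ᵃ S(τ) z dτ` approximate `z`; this is where density of the domain of the
generator comes from. -/
theorem tendsto_inv_smul_orbitIntegral (z : H) :
    Tendsto (fun a : ℝ => orbitIntegral hS hM hω hb a (a⁻¹ • z)) (𝓝[>] 0) (𝓝 z) := by
  have h1 := ((hS.continuous_orbit hM hω hb z).integral_hasStrictDerivAt 0 0).hasDerivAt
    |>.hasDerivWithinAt (s := Ioi 0)
  rw [hasDerivWithinAt_iff_tendsto_slope' (by simp)] at h1
  simp only [max_self, hS.map_zero, ContinuousLinearMap.id_apply] at h1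
  refine h1.congr fun a => ?_
  simp [slope_def_module, orbitIntegral_apply]

end Semigroup

/-! ### Convergence of the Galerkin semigroups -/

section Galerkin

variable {H : Type*} [NormedAddCommGroup H] [InnerProductSpace ℝ H]

section

variable (L : H →ₗ.[ℝ] H) (K : Submodule ℝ H) [FiniteDimensional ℝ K] (hK : K ≤ L.domain)

theorem starProjection_galerkinOperator_apply (z : H) :
    K.starProjection (galerkinOperator L K hK z) = galerkinOperator L K hK z :=
  K.starProjection_eq_self_iff.2 (K.starProjection_apply_mem _)

theorem galerkinOperator_starProjection_apply (z : H) :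
    galerkinOperator L K hK (K.starProjection z) = galerkinOperator L K hK z := by
  have h : K.orthogonalProjectionOnto (K.starProjection z) = K.orthogonalProjectionOnto z := by
    apply Subtype.ext
    exact K.starProjection_eq_self_iff.2 (K.starProjection_apply_mem z)
  simp only [galerkinOperator, ContinuousLinearMap.comp_apply, h]

/-- The Galerkin semigroup `e^{t L_K} Π_K`, regarded as a family of operators on the whole space. -/
noncomputable def galerkinSemigroup (t : ℝ) : H →L[ℝ] H :=
  NormedSpace.exp (t • galerkinOperator L K hK) * K.starProjection

theorem galerkinSemigroup_apply (t : ℝ) (z : H) :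
    galerkinSemigroup L K hK t z
      = NormedSpace.exp (t • galerkinOperator L K hK) (K.starProjection z) := rfl

theorem norm_galerkinSemigroup_le {M ω : ℝ} (hM : 1 ≤ M) {TN : ℝ → H →L[ℝ] H}
    (h : ∀ t : ℝ, 0 ≤ t → ∀ z ∈ K,
      TN t z = NormedSpace.exp (t • galerkinOperator L K hK) z)
    (hb : ∀ t : ℝ, 0 ≤ t → ‖TN t‖ ≤ M * Real.exp (ω * t)) {t : ℝ} (ht : 0 ≤ t) :
    ‖galerkinSemigroup L K hK t‖ ≤ M * Real.exp (ω * t) := by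
  have h0 : 0 ≤ M * Real.exp (ω * t) := by positivity
  refine ContinuousLinearMap.opNorm_le_bound _ h0 fun z => ?_
  rw [galerkinSemigroup_apply, ← h t ht _ (K.starProjection_apply_mem z)]
  exact (TN t).le_of_opNorm_le_of_le (hb t ht) (K.norm_starProjection_apply_le z)

variable [CompleteSpace H]

theorem continuous_galerkinSemigroup : Continuous (galerkinSemigroup L K hK) := by
  have h : Continuous fun t : ℝ => NormedSpace.exp (t • galerkinOperator L K hK) :=
    continuous_iff_continuousAt.2 fun t =>
      (hasDerivAt_exp_smul_const (𝕂 := ℝ) (galerkinOperator L K hK) t).continuousAt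
  exact h.mul continuous_const

end

variable [CompleteSpace H] {L : H →ₗ.[ℝ] H} {S : ℝ → H →L[ℝ] H} {M ω : ℝ}

/-- The error of the Galerkin semigroup on the averages `h(r) = S(r) ∫₀ᵃ S(τ) z dτ`, estimated by
the consistency error: differentiate `r ↦ e^{(t-r) L_K} Π_K h(r)`. -/
theorem norm_starProjection_sub_galerkinSemigroup_orbitIntegral_le
    (hS : IsC0Semigroup S) (hM : 1 ≤ M) (hω : 0 ≤ ω)
    (hb : ∀ t : ℝ, 0 ≤ t → ‖S t‖ ≤ M * Real.exp (ω * t))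
    (K : Submodule ℝ H) [FiniteDimensional ℝ K] (hK : K ≤ L.domain)
    (hWb : ∀ t : ℝ, 0 ≤ t → ‖galerkinSemigroup L K hK t‖ ≤ M * Real.exp (ω * t))
    {a T δ : ℝ} (ha : 0 ≤ a) (z : H)
    (hδ : ∀ r ∈ Icc 0 T, ‖galerkinOperator L K hK (orbitIntegral hS hM hω hb a (S r z))
      - (S a (S r z) - S r z)‖ ≤ δ) {t : ℝ} (ht : t ∈ Icc 0 T) :
    ‖K.starProjection (S t (orbitIntegral hS hM hω hb a z))
        - galerkinSemigroup L K hK t (orbitIntegral hS hM hω hb a z)‖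
      ≤ M * Real.exp (ω * T) * δ * T := by
  set A := galerkinOperator L K hK with hA
  set h : ℝ → H := fun r => ∫ τ in r..r + a, S (max τ 0) z with hh
  set h' : ℝ → H := fun r => S (max (r + a) 0) z - S (max r 0) z with hh'
  have hder : ∀ r, HasDerivAt h (h' r) r := fun r => hasDerivAt_integral_orbit hS hM hω hb a r z
  have hexp : ∀ r, HasDerivAt (fun r => NormedSpace.exp ((t - r) • A))
      (-(NormedSpace.exp ((t - r) • A) * A)) r := fun r => by
    simpa [Function.comp_def] using (hasDerivAt_exp_smul_const (𝕂 := ℝ) A (t - r)).scomp r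
      ((hasDerivAt_id r).const_sub t)
  set p : ℝ → H := fun r => NormedSpace.exp ((t - r) • A) (K.starProjection (h r)) with hp
  have hp' : ∀ r, HasDerivAt p (galerkinSemigroup L K hK (t - r) (h' r - A (h r))) r := fun r => by
    have h1 := (hexp r).clm_apply (K.starProjection.hasFDerivAt.comp_hasDerivAt r (hder r))
    refine h1.congr_deriv ?_
    simp only [galerkinSemigroup_apply, map_sub, neg_apply, mul_apply_eq_comp, Function.comp_apply]
    rw [starProjection_galerkinOperator_apply, galerkinOperator_starProjection_apply]
    abel
  have hc0 : 0 ≤ M * Real.exp (ω * T) := by positivity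
  have hδ0 : 0 ≤ δ := (norm_nonneg _).trans (hδ t ht)
  have hbound : ∀ r ∈ Ico 0 t, ‖galerkinSemigroup L K hK (t - r) (h' r - A (h r))‖
      ≤ M * Real.exp (ω * T) * δ := fun r hr => by
    refine ContinuousLinearMap.le_of_opNorm_le_of_le _ ((hWb _ (sub_nonneg.2 hr.2.le)).trans
      (mul_exp_le_mul_exp hM hω (by linarith [hr.1, ht.2]))) ?_
    have h1 := hδ r ⟨hr.1, hr.2.le.trans ht.2⟩
    rw [norm_sub_rev, orbitIntegral_semigroup_apply hS hM hω hb ha hr.1,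
      ← ContinuousLinearMap.comp_apply, ← hS.map_add a r ha hr.1] at h1
    rw [add_comm a r] at h1
    simpa only [hh', max_eq_left (add_nonneg hr.1 ha), max_eq_left hr.1] using h1
  have hfin := norm_image_sub_le_of_norm_deriv_le_segment'
    (fun r (_ : r ∈ Icc 0 t) => (hp' r).hasDerivWithinAt) hbound t ⟨ht.1, le_rfl⟩
  have e1 : p t = K.starProjection (S t (orbitIntegral hS hM hω hb a z)) := by
    rw [semigroup_apply_orbitIntegral hS hM hω hb ha ht.1]
    simp [hp, hh, NormedSpace.exp_zero]
  have e2 : p 0 = galerkinSemigroup L K hK t (orbitIntegral hS hM hω hb a z) := by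
    simp [hp, hh, galerkinSemigroup_apply, orbitIntegral_apply, hA]
  rw [e1, e2, sub_zero] at hfin
  exact hfin.trans (mul_le_mul_of_nonneg_left ht.2 (mul_nonneg hc0 hδ0))

/-- The Trotter–Kato theorem for Galerkin approximations. -/
theorem eventually_norm_galerkinSemigroup_sub_le
    (hS : IsC0Semigroup S) (hLS : IsInfinitesimalGenerator L S)
    (K : ℕ → Submodule ℝ H) [∀ N, FiniteDimensional ℝ (K N)] (hKL : ∀ N, K N ≤ L.domain)
    (hK : ∀ x : H, Tendsto (fun N => ‖(K N).starProjection x - x‖) atTop (𝓝 0))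
    (hM : 1 ≤ M) (hω : 0 ≤ ω)
    (hb : ∀ t : ℝ, 0 ≤ t → ‖S t‖ ≤ M * Real.exp (ω * t))
    (hWb : ∀ N, ∀ t : ℝ, 0 ≤ t →
      ‖galerkinSemigroup L (K N) (hKL N) t‖ ≤ M * Real.exp (ω * t))
    (hcons : ∀ φ : L.domain,
      Tendsto (fun N => ‖galerkinOperator L (K N) (hKL N) (φ : H) - L φ‖) atTop (𝓝 0))
    {T : ℝ} (hT : 0 ≤ T) (z : H) {ε : ℝ} (hε : 0 < ε) :
    ∀ᶠ N in atTop, ∀ t ∈ Icc 0 T,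
      ‖galerkinSemigroup L (K N) (hKL N) t z - S t z‖ ≤ ε := by
  set c : ℝ := M * Real.exp (ω * T) with hc
  have hc0 : 0 < c := by positivity
  obtain ⟨a, haz, ha⟩ : ∃ a : ℝ,
      ‖orbitIntegral hS hM hω hb a (a⁻¹ • z) - z‖ < ε / (4 * c) ∧ 0 < a := by
    have h1 := (tendsto_iff_norm_sub_tendsto_zero.1
      (tendsto_inv_smul_orbitIntegral hS hM hω hb z)).eventually_lt_const
        (show 0 < ε / (4 * c) by positivity)
    exact (h1.and self_mem_nhdsWithin).exists
  set J := orbitIntegral hS hM hω hb a with hJ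
  set z' := a⁻¹ • z with hz'
  have horb : Continuous fun r : ℝ => S (max r 0) z' := hS.continuous_orbit hM hω hb z'
  have horb' : ContinuousOn (fun r : ℝ => S r z') (Icc 0 T) :=
    horb.continuousOn.congr fun r hr => by simp only [max_eq_left hr.1]
  have hcpt : IsCompact ((fun r : ℝ => S r z') '' Icc 0 T) :=
    isCompact_Icc.image_of_continuousOn horb'
  -- the operators `L_N J` converge pointwise to the bounded operator `L J = S(a) - 1`
  have hpt : ∀ w, Tendsto (fun N => ((galerkinOperator L (K N) (hKL N)).comp J) w) atTop
      (𝓝 ((S a - 1) w)) := fun w => by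
    obtain ⟨φ, hφ1, hφ2⟩ := (LinearPMap.mem_graph_iff L).1
      (orbitIntegral_mem_graph hS hM hω hb hLS ha.le w)
    rw [tendsto_iff_norm_sub_tendsto_zero]
    have := hcons φ
    rw [hφ1, hφ2] at this
    exact this
  obtain ⟨c₁, hc₁⟩ := banach_steinhaus (𝕜 := ℝ) (𝕜₂ := ℝ) (σ₁₂ := RingHom.id ℝ)
    (g := fun N => (galerkinOperator L (K N) (hKL N)).comp J) fun w => by
      obtain ⟨C, hC⟩ := (Metric.isBounded_range_of_tendsto _ (hpt w)).exists_norm_le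
      exact ⟨C, fun N => hC _ (mem_range_self N)⟩
  have hδ : 0 < ε / (4 * c * (T + 1)) := by positivity
  have h1 := eventually_forall_mem_norm_sub_le_of_totallyBounded (I := (univ : Set Unit))
    (A := fun N _ => (galerkinOperator L (K N) (hKL N)).comp J) (B := fun _ => S a - 1)
    (c := max c₁ ‖S a - 1‖) (fun N _ _ => (hc₁ N).trans (le_max_left _ _))
    (fun _ _ => le_max_right _ _)
    (fun w η hη => by
      filter_upwards [(tendsto_iff_norm_sub_tendsto_zero.1 (hpt w)).eventually_le_const hη] with
        N hN _ _ using hN)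
    hcpt.totallyBounded hδ
  have h2 := eventually_forall_mem_norm_sub_le_of_totallyBounded (I := (univ : Set Unit))
    (A := fun N _ => (K N).starProjection) (B := fun _ => (1 : H →L[ℝ] H)) (c := 1)
    (fun N _ _ => (K N).starProjection_norm_le)
    (fun _ _ => ContinuousLinearMap.norm_id_le)
    (fun w η hη => by
      filter_upwards [(hK w).eventually_le_const hη] with N hN _ _ using hN)
    (hcpt.image J.continuous).totallyBounded (show 0 < ε / 4 by positivity)
  filter_upwards [h1, h2] with N hN1 hN2 t ht
  have hJS : S t (J z') = J (S t z') := by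
    rw [hJ, semigroup_apply_orbitIntegral hS hM hω hb ha.le ht.1,
      orbitIntegral_semigroup_apply hS hM hω hb ha.le ht.1]
  have b1 : ‖(K N).starProjection (S t (J z')) - galerkinSemigroup L (K N) (hKL N) t (J z')‖
      ≤ ε / 4 := by
    refine (norm_starProjection_sub_galerkinSemigroup_orbitIntegral_le hS hM hω hb (K N) (hKL N)
      (hWb N) ha.le z' (fun r hr => hN1 () trivial _ (mem_image_of_mem _ hr)) ht).trans ?_
    rw [← hc, show c * (ε / (4 * c * (T + 1))) * T = ε / 4 * (T / (T + 1)) by field_simp]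
    exact mul_le_of_le_one_right (by positivity) ((div_le_one (by positivity)).2 (by linarith))
  have b2 : ‖(K N).starProjection (S t (J z')) - S t (J z')‖ ≤ ε / 4 := by
    rw [hJS]
    exact hN2 () trivial _ (mem_image_of_mem _ (mem_image_of_mem _ ht))
  have hle : M * Real.exp (ω * t) ≤ c := mul_exp_le_mul_exp hM hω ht.2
  have hcc : c * (ε / (4 * c)) = ε / 4 := by field_simp
  have b3 : ‖galerkinSemigroup L (K N) (hKL N) t (J z' - z)‖ ≤ ε / 4 :=
    (ContinuousLinearMap.le_of_opNorm_le_of_le _ ((hWb N t ht.1).trans hle) haz.le).trans_eq hcc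
  have b4 : ‖S t (J z' - z)‖ ≤ ε / 4 :=
    (ContinuousLinearMap.le_of_opNorm_le_of_le _ ((hb t ht.1).trans hle) haz.le).trans_eq hcc
  have e : galerkinSemigroup L (K N) (hKL N) t z - S t z
      = ((K N).starProjection (S t (J z')) - S t (J z'))
        - ((K N).starProjection (S t (J z')) - galerkinSemigroup L (K N) (hKL N) t (J z'))
        - galerkinSemigroup L (K N) (hKL N) t (J z' - z) + S t (J z' - z) := by
    simp only [map_sub]; abel
  rw [e]
  refine (norm_add_le _ _).trans ?_
  have := (norm_sub_le (((K N).starProjection (S t (J z')) - S t (J z'))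
        - ((K N).starProjection (S t (J z')) - galerkinSemigroup L (K N) (hKL N) t (J z')))
        (galerkinSemigroup L (K N) (hKL N) t (J z' - z)))
  have := norm_sub_le ((K N).starProjection (S t (J z')) - S t (J z'))
        ((K N).starProjection (S t (J z')) - galerkinSemigroup L (K N) (hKL N) t (J z'))
  linarith

end Galerkin

/-! ### Comparison of mild solutions -/

section Mild

variable {H V : Type*} [NormedAddCommGroup H] [InnerProductSpace ℝ H]
  [NormedAddCommGroup V]

theorem aestronglyMeasurable_apply_sub {W : ℝ → H →L[ℝ] H}
    (hW : Continuous fun p : ℝ × H => W (max p.1 0) p.2) {a s : ℝ} {f : ℝ → H}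
    (hf : AEStronglyMeasurable f (volume.restrict (Icc a s))) :
    AEStronglyMeasurable (fun r => W (s - r) (f r)) (volume.restrict (Icc a s)) := by
  have h1 : AEStronglyMeasurable (fun r => W (max (s - r) 0) (f r)) (volume.restrict (Icc a s)) :=
    hW.comp_aestronglyMeasurable
      ((continuous_const.sub continuous_id).aestronglyMeasurable.prodMk hf)
  refine h1.congr ?_
  filter_upwards [ae_restrict_mem measurableSet_Icc] with r hr
  rw [max_eq_left (sub_nonneg.2 hr.2)]

theorem intervalIntegrable_apply_sub {W : ℝ → H →L[ℝ] H}
    (hW : Continuous fun p : ℝ × H => W (max p.1 0) p.2) {a s c B : ℝ} (has : a ≤ s)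
    (hc : ∀ t ∈ Icc 0 (s - a), ‖W t‖ ≤ c) {f : ℝ → H}
    (hf : AEStronglyMeasurable f (volume.restrict (Icc a s)))
    (hB : ∀ᵐ r ∂(volume.restrict (Icc a s)), ‖f r‖ ≤ B) :
    IntervalIntegrable (fun r => W (s - r) (f r)) volume a s := by
  rw [intervalIntegrable_iff_integrableOn_Icc_of_le has]
  refine Integrable.mono' (integrable_const (c * B)) (aestronglyMeasurable_apply_sub hW hf) ?_
  filter_upwards [hB, ae_restrict_mem measurableSet_Icc] with r hr hrs
  exact (W _).le_of_opNorm_le_of_le (hc _ ⟨sub_nonneg.2 hrs.2, sub_le_sub_left hrs.1 _⟩) hr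

theorem ae_restrict_Icc_mono {a s T : ℝ} (hs : s ≤ T) {p : ℝ → Prop}
    (h : ∀ᵐ r ∂(volume.restrict (Icc a T)), p r) : ∀ᵐ r ∂(volume.restrict (Icc a s)), p r :=
  ae_restrict_of_ae_restrict_of_subset (Icc_subset_Icc_right hs) h

/-- Two mild solutions for the same data but different propagators `W₁`, `W₂` are close if the
propagators are close on a set `Q` containing the initial state, the control forces, and the
nonlinearity along one of the two solutions. -/
theorem IsMildSolution.norm_sub_le {W₁ W₂ : ℝ → H →L[ℝ] H}
    (hW₁ : Continuous fun p : ℝ × H => W₁ (max p.1 0) p.2)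
    (hW₂ : Continuous fun p : ℝ × H => W₂ (max p.1 0) p.2)
    {F : H → H} (hF : Continuous F) {C : V → H} (hC : Continuous C) {U : Set V} (hU : IsCompact U)
    {a T : ℝ} {x : H} {u : ℝ → V} {y₁ y₂ : ℝ → H}
    (hu : AEStronglyMeasurable u (volume.restrict (Icc a T)))
    (huU : ∀ᵐ r ∂(volume.restrict (Icc a T)), u r ∈ U)
    (h₁ : IsMildSolution W₁ F C T a x u y₁) (h₂ : IsMildSolution W₂ F C T a x u y₂)
    {c k R δ : ℝ} (hc₀ : 0 ≤ c) (hk₀ : 0 ≤ k) (hδ₀ : 0 ≤ δ)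
    (hc₁ : ∀ t ∈ Icc 0 (T - a), ‖W₁ t‖ ≤ c) (hc₂ : ∀ t ∈ Icc 0 (T - a), ‖W₂ t‖ ≤ c)
    (hk : ∀ z₁ ∈ Metric.closedBall (0 : H) R, ∀ z₂ ∈ Metric.closedBall (0 : H) R,
      ‖F z₁ - F z₂‖ ≤ k * ‖z₁ - z₂‖)
    (hR₁ : ∀ t ∈ Icc a T, ‖y₁ t‖ ≤ R) (hR₂ : ∀ t ∈ Icc a T, ‖y₂ t‖ ≤ R)
    {Q : Set H} (hδ : ∀ t ∈ Icc 0 (T - a), ∀ z ∈ Q, ‖W₁ t z - W₂ t z‖ ≤ δ)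
    (hxQ : x ∈ Q) (hFQ : ∀ t ∈ Icc a T, F (y₂ t) ∈ Q) (hCQ : ∀ w ∈ U, C w ∈ Q) :
    ∀ s ∈ Icc a T, ‖y₁ s - y₂ s‖ ≤ δ * (1 + 2 * (T - a)) * Real.exp (c * k * (T - a)) := by
  intro s hs
  have hd : ContinuousOn (fun r => ‖y₁ r - y₂ r‖) (Icc a T) := (h₁.1.sub h₂.1).norm
  have hCu : AEStronglyMeasurable (fun r => C (u r)) (volume.restrict (Icc a T)) :=
    hC.comp_aestronglyMeasurable hu
  obtain ⟨B, hB⟩ := (hU.image hC).isBounded.exists_norm_le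
  have hCB : ∀ᵐ r ∂(volume.restrict (Icc a T)), ‖C (u r)‖ ≤ B :=
    huU.mono fun r hr => hB _ (mem_image_of_mem _ hr)
  have hFi : ∀ {W : ℝ → H →L[ℝ] H} {y : ℝ → H} {s : ℝ}, s ∈ Icc a T →
      (Continuous fun p : ℝ × H => W (max p.1 0) p.2) → (∀ t ∈ Icc 0 (T - a), ‖W t‖ ≤ c) →
      ContinuousOn y (Icc a T) →
      IntervalIntegrable (fun r => W (s - r) (F (y r))) volume a s := by
    intro W y s hs hW hc hy
    have hFy : ContinuousOn (fun r => F (y r)) (Icc a T) := hF.comp_continuousOn hy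
    obtain ⟨B', hB'⟩ := isCompact_Icc.exists_bound_of_continuousOn hFy
    exact intervalIntegrable_apply_sub hW hs.1
      (fun t ht => hc t ⟨ht.1, ht.2.trans (by linarith [hs.2])⟩)
      ((hFy.mono (Icc_subset_Icc_right hs.2)).aestronglyMeasurable measurableSet_Icc)
      (ae_restrict_Icc_mono hs.2 ((ae_restrict_mem measurableSet_Icc).mono hB'))
  have hCi : ∀ {W : ℝ → H →L[ℝ] H} {s : ℝ}, s ∈ Icc a T →
      (Continuous fun p : ℝ × H => W (max p.1 0) p.2) → (∀ t ∈ Icc 0 (T - a), ‖W t‖ ≤ c) →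
      IntervalIntegrable (fun r => W (s - r) (C (u r))) volume a s := by
    intro W s hs hW hc
    exact intervalIntegrable_apply_sub hW hs.1
      (fun t ht => hc t ⟨ht.1, ht.2.trans (by linarith [hs.2])⟩)
      (hCu.mono_measure (Measure.restrict_mono (Icc_subset_Icc_right hs.2) le_rfl))
      (ae_restrict_Icc_mono hs.2 hCB)
  have hmain : ∀ s ∈ Icc a T, ‖y₁ s - y₂ s‖
      ≤ δ * (1 + 2 * (T - a)) + c * k * ∫ r in a..s, ‖y₁ r - y₂ r‖ := by
    intro s hs
    have hmem : ∀ r ∈ Icc a s, s - r ∈ Icc 0 (T - a) := fun r hr =>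
      ⟨sub_nonneg.2 hr.2, by linarith [hr.1, hs.2]⟩
    have hdi : IntervalIntegrable (fun r => c * k * ‖y₁ r - y₂ r‖) volume a s :=
      (hd.mono (by
        rw [uIcc_of_le hs.1]
        exact Icc_subset_Icc_right hs.2)).intervalIntegrable.const_mul _
    have i1 : ‖(∫ r in a..s, W₁ (s - r) (F (y₁ r))) - ∫ r in a..s, W₂ (s - r) (F (y₂ r))‖
        ≤ c * k * (∫ r in a..s, ‖y₁ r - y₂ r‖) + (s - a) * δ := by
      rw [← intervalIntegral.integral_sub (hFi hs hW₁ hc₁ h₁.1) (hFi hs hW₂ hc₂ h₂.1)]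
      have h3 : ∫ r in a..s, (c * k * ‖y₁ r - y₂ r‖ + δ)
          = c * k * (∫ r in a..s, ‖y₁ r - y₂ r‖) + (s - a) * δ := by
        rw [intervalIntegral.integral_add hdi intervalIntegrable_const,
          intervalIntegral.integral_const_mul, intervalIntegral.integral_const, smul_eq_mul]
      rw [← h3]
      refine intervalIntegral.norm_integral_le_of_norm_le hs.1
        (Eventually.of_forall fun r hr => ?_) (hdi.add intervalIntegrable_const)
      have hr' := Ioc_subset_Icc_self hr
      have hrT : r ∈ Icc a T := ⟨hr'.1, hr'.2.trans hs.2⟩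
      have e : W₁ (s - r) (F (y₁ r)) - W₂ (s - r) (F (y₂ r))
          = W₁ (s - r) (F (y₁ r) - F (y₂ r))
            + (W₁ (s - r) (F (y₂ r)) - W₂ (s - r) (F (y₂ r))) := by
        rw [map_sub]; abel
      rw [e, mul_assoc]
      refine (norm_add_le _ _).trans (add_le_add ?_ (hδ _ (hmem r hr') _ (hFQ r hrT)))
      exact (W₁ _).le_of_opNorm_le_of_le (hc₁ _ (hmem r hr'))
        (hk _ (mem_closedBall_zero_iff.2 (hR₁ r hrT)) _ (mem_closedBall_zero_iff.2 (hR₂ r hrT)))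
    have i2 : ‖(∫ r in a..s, W₁ (s - r) (C (u r))) - ∫ r in a..s, W₂ (s - r) (C (u r))‖
        ≤ (s - a) * δ := by
      rw [← intervalIntegral.integral_sub (hCi hs hW₁ hc₁) (hCi hs hW₂ hc₂)]
      have h3 : ∫ _ in a..s, δ = (s - a) * δ := by
        rw [intervalIntegral.integral_const, smul_eq_mul]
      rw [← h3]
      refine intervalIntegral.norm_integral_le_of_norm_le hs.1 ?_ intervalIntegrable_const
      filter_upwards [(ae_restrict_iff' measurableSet_Icc).1 huU] with r hrU hr
      have hr' := Ioc_subset_Icc_self hr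
      exact hδ _ (hmem r hr') _ (hCQ _ (hrU ⟨hr'.1, hr'.2.trans hs.2⟩))
    have i3 : ‖W₁ (s - a) x - W₂ (s - a) x‖ ≤ δ := hδ _ (hmem a ⟨le_rfl, hs.1⟩) _ hxQ
    have e : y₁ s - y₂ s = (W₁ (s - a) x - W₂ (s - a) x)
        + ((∫ r in a..s, W₁ (s - r) (F (y₁ r))) - ∫ r in a..s, W₂ (s - r) (F (y₂ r)))
        + ((∫ r in a..s, W₁ (s - r) (C (u r))) - ∫ r in a..s, W₂ (s - r) (C (u r))) := by
      rw [h₁.2 s hs, h₂.2 s hs]; abel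
    rw [e]
    refine (norm_add₃_le.trans (add_le_add (add_le_add i3 i1) i2)).trans ?_
    have : (s - a) * δ ≤ (T - a) * δ := by gcongr; exact hs.2
    linarith
  refine (le_mul_exp_of_le_add_mul_integral (mul_nonneg hc₀ hk₀) hd
    (fun _ _ => norm_nonneg _) hmain s hs).trans ?_
  have : 0 ≤ T - a := by linarith [hs.1, hs.2]
  gcongr
  exact hs.2

/-- Uniqueness of mild solutions on every time interval, for locally Lipschitz `F`. -/
theorem IsMildSolution.eqOn {W : ℝ → H →L[ℝ] H}
    (hW : Continuous fun p : ℝ × H => W (max p.1 0) p.2)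
    {F : H → H} (hF : LipschitzOnBalls F) {C : V → H} (hC : Continuous C)
    {U : Set V} (hU : IsCompact U) {a T : ℝ} {x : H} {u : ℝ → V} {y₁ y₂ : ℝ → H}
    (hu : AEStronglyMeasurable u (volume.restrict (Icc a T)))
    (huU : ∀ᵐ r ∂(volume.restrict (Icc a T)), u r ∈ U)
    {c : ℝ} (hc : ∀ t ∈ Icc 0 (T - a), ‖W t‖ ≤ c)
    (h₁ : IsMildSolution W F C T a x u y₁) (h₂ : IsMildSolution W F C T a x u y₂) :
    EqOn y₁ y₂ (Icc a T) := by
  intro s hs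
  obtain ⟨R₁, hR₁⟩ := isCompact_Icc.exists_bound_of_continuousOn h₁.1
  obtain ⟨R₂, hR₂⟩ := isCompact_Icc.exists_bound_of_continuousOn h₂.1
  have hR₀ : 0 ≤ R₁ := (norm_nonneg _).trans (hR₁ s hs)
  obtain ⟨k, hk₀, hk⟩ := hF (max R₁ R₂ + 1) (by linarith [le_max_left R₁ R₂])
  have hc₀ : 0 ≤ c := (norm_nonneg _).trans
    (hc 0 ⟨le_rfl, by linarith [hs.1, hs.2]⟩)
  have h := h₁.norm_sub_le hW hW hF.continuous hC hU hu huU h₂ hc₀ hk₀.le le_rfl hc hc hk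
    (fun t ht => (hR₁ t ht).trans (by linarith [le_max_left R₁ R₂]))
    (fun t ht => (hR₂ t ht).trans (by linarith [le_max_right R₁ R₂]))
    (Q := univ) (by simp) trivial (fun _ _ => trivial) (fun _ _ => trivial) s hs
  rw [zero_mul, zero_mul] at h
  exact sub_eq_zero.1 (norm_le_zero_iff.1 h)

variable [CompleteSpace H]

/-- By Duhamel's formula, solutions of the Galerkin equation are mild solutions for the Galerkin
semigroup. -/
theorem IsGalerkinSolution.isMildSolution {L : H →ₗ.[ℝ] H} {K : Submodule ℝ H}
    [FiniteDimensional ℝ K] {hK : K ≤ L.domain} {F : H → H} (hF : Continuous F)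
    {C : V → H} (hC : Continuous C) {U : Set V} (hU : IsCompact U) {a T : ℝ} {x : H} {u : ℝ → V}
    {y : ℝ → H} (hu : AEStronglyMeasurable u (volume.restrict (Icc a T)))
    (huU : ∀ᵐ r ∂(volume.restrict (Icc a T)), u r ∈ U)
    (h : IsGalerkinSolution L K hK F C T a (K.starProjection x) u y) :
    IsMildSolution (galerkinSemigroup L K hK) F C T a x u y := by
  refine ⟨h.1, fun s hs => ?_⟩
  have hss : Icc a s ⊆ Icc a T := Icc_subset_Icc_right hs.2
  have hW : Continuous fun p : ℝ × H => galerkinSemigroup L K hK (max p.1 0) p.2 :=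
    ((continuous_galerkinSemigroup L K hK).comp (continuous_fst.max continuous_const)).clm_apply
      continuous_snd
  obtain ⟨c, hc⟩ := (isCompact_Icc (a := (0 : ℝ)) (b := s - a)).exists_bound_of_continuousOn
    (continuous_galerkinSemigroup L K hK).continuousOn
  have hys : ContinuousOn y (Icc a s) := h.1.mono hss
  have hFy : ContinuousOn (fun r => F (y r)) (Icc a s) := hF.comp_continuousOn hys
  obtain ⟨B', hB'⟩ := isCompact_Icc.exists_bound_of_continuousOn hFy
  obtain ⟨B, hB⟩ := (hU.image hC).isBounded.exists_norm_le
  have hCB : ∀ᵐ r ∂(volume.restrict (Icc a s)), ‖C (u r)‖ ≤ B :=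
    ae_restrict_Icc_mono hs.2 (huU.mono fun r hr => hB _ (mem_image_of_mem _ hr))
  have hCu : AEStronglyMeasurable (fun r => C (u r)) (volume.restrict (Icc a s)) :=
    hC.comp_aestronglyMeasurable (hu.mono_measure (Measure.restrict_mono hss le_rfl))
  have hCui : IntervalIntegrable (fun r => C (u r)) volume a s := by
    rw [intervalIntegrable_iff_integrableOn_Icc_of_le hs.1]
    exact Integrable.mono' (integrable_const B) hCu hCB
  have hFyi : IntervalIntegrable (fun r => F (y r)) volume a s :=
    ContinuousOn.intervalIntegrable (by rwa [uIcc_of_le hs.1])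
  have hg : IntervalIntegrable
      (fun r => K.starProjection (F (y r)) + K.starProjection (C (u r))) volume a s :=
    IntervalIntegrable.add ⟨K.starProjection.integrable_comp hFyi.1,
      K.starProjection.integrable_comp hFyi.2⟩ ⟨K.starProjection.integrable_comp hCui.1,
      K.starProjection.integrable_comp hCui.2⟩
  have hD := eq_exp_apply_add_integral_of_eq_add_integral (galerkinOperator L K hK) hs.1 hys hg
    (ξ := K.starProjection x) (fun r hr => by
      rw [h.2 r (hss hr)]
      simp only [add_assoc])
  rw [hD, galerkinSemigroup_apply, add_assoc, ← intervalIntegral.integral_add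
    (intervalIntegrable_apply_sub hW hs.1 hc (hFy.aestronglyMeasurable measurableSet_Icc)
      ((ae_restrict_mem measurableSet_Icc).mono hB'))
    (intervalIntegrable_apply_sub hW hs.1 hc hCu hCB)]
  simp only [galerkinSemigroup_apply, map_add]

end Mild

/-! ### Uniform convergence of the states -/

section States

variable {H V : Type*} [NormedAddCommGroup H] [InnerProductSpace ℝ H]

/-- A bounded set that is uniformly approximated by finite-dimensional projections is totally
bounded. -/
theorem totallyBounded_of_norm_sub_starProjection_le {Y : Set H} {R : ℝ}
    (hR : ∀ y ∈ Y, ‖y‖ ≤ R) (K : ℕ → Submodule ℝ H) [∀ N, FiniteDimensional ℝ (K N)]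
    (h : ∀ ε > 0, ∃ N, ∀ y ∈ Y, ‖y - (K N).starProjection y‖ ≤ ε) : TotallyBounded Y := by
  refine Metric.totallyBounded_iff.2 fun ε hε => ?_
  obtain ⟨N, hN⟩ := h (ε / 2) (half_pos hε)
  have hcpt : IsCompact (((↑) : K N → H) '' Metric.closedBall 0 R) :=
    (isCompact_closedBall _ _).image continuous_subtype_val
  obtain ⟨t, ht, hcover⟩ := Metric.totallyBounded_iff.1 hcpt.totallyBounded (ε / 2) (half_pos hε)
  refine ⟨t, ht, fun y hy => ?_⟩
  have hmem : (K N).starProjection y ∈ ((↑) : K N → H) '' Metric.closedBall 0 R := by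
    refine ⟨⟨_, (K N).starProjection_apply_mem y⟩, ?_, rfl⟩
    rw [mem_closedBall_zero_iff]
    exact ((K N).norm_starProjection_apply_le y).trans (hR y hy)
  obtain ⟨w, hw, hwy⟩ := mem_iUnion₂.1 (hcover hmem)
  refine mem_iUnion₂.2 ⟨w, hw, ?_⟩
  rw [mem_ball_iff_norm] at hwy ⊢
  calc ‖y - w‖ = ‖(y - (K N).starProjection y) + ((K N).starProjection y - w)‖ := by
        rw [sub_add_sub_cancel]
    _ ≤ ‖y - (K N).starProjection y‖ + ‖(K N).starProjection y - w‖ := norm_add_le _ _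
    _ < ε := by linarith [hN y hy]

variable [CompleteSpace H] [NormedAddCommGroup V]

/-- Over all admissible controls, the Galerkin states started at time `0` converge uniformly. The
states `y(s; u)` of the limit equation form a totally bounded set, so their image under `F` is
contained in a compact set, on which the Galerkin semigroups converge uniformly. -/
theorem eventually_norm_isGalerkinSolution_sub_isMildSolution_le
    {L : H →ₗ.[ℝ] H} {S : ℝ → H →L[ℝ] H}
    (hS : IsC0Semigroup S) (hLS : IsInfinitesimalGenerator L S)
    {K : ℕ → Submodule ℝ H} [∀ N, FiniteDimensional ℝ (K N)] {hKL : ∀ N, K N ≤ L.domain}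
    (hK : ∀ x : H, Tendsto (fun N => ‖(K N).starProjection x - x‖) atTop (𝓝 0))
    {M ω : ℝ} (hM : 1 ≤ M) (hω : 0 ≤ ω)
    (hb : ∀ t : ℝ, 0 ≤ t → ‖S t‖ ≤ M * Real.exp (ω * t))
    (hWb : ∀ N, ∀ t : ℝ, 0 ≤ t →
      ‖galerkinSemigroup L (K N) (hKL N) t‖ ≤ M * Real.exp (ω * t))
    (hcons : ∀ φ : L.domain,
      Tendsto (fun N => ‖galerkinOperator L (K N) (hKL N) (φ : H) - L φ‖) atTop (𝓝 0))
    {F : H → H} (hF : LipschitzOnBalls F) {C : V → H} (hC : Continuous C)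
    {T : ℝ} (hT : 0 < T) {q : ℝ≥0∞} {U : Set V} (hU : IsCompact U) {x : H} {R : ℝ}
    (hR : ∀ u ∈ admissibleControls q U T,
      (∀ y, IsMildSolution S F C T 0 x u y → ∀ t ∈ Icc 0 T, ‖y t‖ ≤ R) ∧
      (∀ N, ∀ y, IsGalerkinSolution L (K N) (hKL N) F C T 0 ((K N).starProjection x) u y →
        ∀ t ∈ Icc 0 T, ‖y t‖ ≤ R))
    (hres : Tendsto
      (fun N => ⨆ u ∈ admissibleControls q U T, ⨆ y ∈ {y | IsMildSolution S F C T 0 x u y},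
        ⨆ t ∈ Icc 0 T, ‖y t - (K N).starProjection (y t)‖ₑ) atTop (𝓝 0))
    {ε : ℝ} (hε : 0 < ε) :
    ∀ᶠ N in atTop, ∀ u ∈ admissibleControls q U T, ∀ y y',
      IsGalerkinSolution L (K N) (hKL N) F C T 0 ((K N).starProjection x) u y →
      IsMildSolution S F C T 0 x u y' → ∀ s ∈ Icc 0 T, ‖y s - y' s‖ ≤ ε := by
  set Y : Set H := {z | ∃ u ∈ admissibleControls q U T, ∃ y, IsMildSolution S F C T 0 x u y ∧
    ∃ t ∈ Icc 0 T, y t = z} with hY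
  have hYt : TotallyBounded Y := by
    refine totallyBounded_of_norm_sub_starProjection_le (R := R) ?_ K fun η hη => ?_
    · rintro _ ⟨u, hu, y, hy, t, ht, rfl⟩
      exact (hR u hu).1 y hy t ht
    · obtain ⟨N, hN⟩ := (hres.eventually_le_const
        (ENNReal.ofReal_pos.2 hη)).exists
      refine ⟨N, ?_⟩
      rintro _ ⟨u, hu, y, hy, t, ht, rfl⟩
      rw [← ENNReal.ofReal_le_ofReal_iff hη.le, ofReal_norm]
      exact (le_iSup₂_of_le u hu (le_iSup₂_of_le y hy
        (le_iSup₂ (f := fun t _ => ‖y t - (K N).starProjection (y t)‖ₑ) t ht))).trans hN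
  have hYc : IsCompact (closure Y) :=
    isCompact_iff_totallyBounded_isComplete.2 ⟨hYt.closure, isClosed_closure.isComplete⟩
  set Q : Set H := insert x (F '' closure Y ∪ C '' U) with hQ
  have hQc : IsCompact Q := ((hYc.image hF.continuous).union (hU.image hC)).insert x
  obtain ⟨k, hk₀, hk⟩ := hF (|R| + 1) (by positivity)
  set c : ℝ := M * Real.exp (ω * T) with hc
  have hc₀ : 0 ≤ c := by positivity
  set D : ℝ := (1 + 2 * (T - 0)) * Real.exp (c * k * (T - 0)) with hD
  have hD₀ : 0 < D := mul_pos (by linarith) (Real.exp_pos _)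
  have hcW : ∀ N, ∀ t ∈ Icc 0 (T - 0), ‖galerkinSemigroup L (K N) (hKL N) t‖ ≤ c :=
    fun N t ht => (hWb N t ht.1).trans (mul_exp_le_mul_exp hM hω (by linarith [ht.2]))
  have hcS : ∀ t ∈ Icc 0 (T - 0), ‖S t‖ ≤ c :=
    fun t ht => (hb t ht.1).trans (mul_exp_le_mul_exp hM hω (by linarith [ht.2]))
  have hev := eventually_forall_mem_norm_sub_le_of_totallyBounded (I := Icc 0 (T - 0))
    (A := fun N t => galerkinSemigroup L (K N) (hKL N) t) (B := S) hcW hcS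
    (fun z η hη => eventually_norm_galerkinSemigroup_sub_le hS hLS K hKL hK hM hω hb hWb hcons
      (by linarith) z hη) hQc.totallyBounded (div_pos hε hD₀)
  filter_upwards [hev] with N hN u hu y y' hy hy' s hs
  have hWc : Continuous fun p : ℝ × H => galerkinSemigroup L (K N) (hKL N) (max p.1 0) p.2 :=
    ((continuous_galerkinSemigroup L (K N) (hKL N)).comp
      (continuous_fst.max continuous_const)).clm_apply continuous_snd
  have h := (hy.isMildSolution hF.continuous hC hU hu.1.1 hu.2).norm_sub_le hWc
    (hS.continuous_apply hM hω hb) hF.continuous hC hU hu.1.1 hu.2 hy' hc₀ hk₀.le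
    (div_pos hε hD₀).le (hcW N) hcS hk
    (fun t ht => ((hR u hu).2 N y hy t ht).trans (by linarith [le_abs_self R]))
    (fun t ht => ((hR u hu).1 y' hy' t ht).trans (by linarith [le_abs_self R]))
    hN (mem_insert _ _)
    (fun t ht => Or.inr (Or.inl (mem_image_of_mem _
      (subset_closure ⟨u, hu, y', hy', t, ht, rfl⟩))))
    (fun w hw => Or.inr (Or.inr (mem_image_of_mem _ hw))) s hs
  rwa [mul_assoc, ← hD, div_mul_cancel₀ _ hD₀.ne'] at h

end States

/-! ### Time invariance -/

section Shift

variable {H V : Type*} [NormedAddCommGroup H] [InnerProductSpace ℝ H]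

theorem IsMildSolution.comp_sub_right {S : ℝ → H →L[ℝ] H} {F : H → H} {C : V → H} {T : ℝ} {x : H}
    {u w : ℝ → V} {y : ℝ → H} (h : IsMildSolution S F C T 0 x u y) {t : ℝ} (ht : 0 ≤ t)
    (hw : ∀ r ∈ Icc t T, w r = u (r - t)) :
    IsMildSolution S F C T t x w fun s => y (s - t) := by
  have hm : ∀ s ∈ Icc t T, s - t ∈ Icc 0 T := fun s hs =>
    ⟨sub_nonneg.2 hs.1, by linarith [hs.2]⟩
  refine ⟨h.1.comp (by fun_prop) hm, fun s hs => ?_⟩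
  have h1 := intervalIntegral.integral_comp_sub_right (a := t) (b := s)
    (fun r => S (s - t - r) (F (y r))) t
  have h2 := intervalIntegral.integral_comp_sub_right (a := t) (b := s)
    (fun r => S (s - t - r) (C (u r))) t
  simp only [sub_self, sub_sub_sub_cancel_right] at h1 h2
  have h3 : ∫ r in t..s, S (s - r) (C (w r)) = ∫ r in t..s, S (s - r) (C (u (r - t))) := by
    refine intervalIntegral.integral_congr fun r hr => ?_
    rw [uIcc_of_le hs.1] at hr
    simp only [hw r ⟨hr.1, hr.2.trans hs.2⟩]
  have h4 := h.2 (s - t) (hm s hs)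
  rw [sub_zero] at h4
  rw [h3, h1, h2]
  exact h4

theorem IsGalerkinSolution.comp_sub_right {L : H →ₗ.[ℝ] H} {K : Submodule ℝ H}
    [FiniteDimensional ℝ K] {hK : K ≤ L.domain} {F : H → H} {C : V → H} {T : ℝ} {ξ : H}
    {u w : ℝ → V} {y : ℝ → H} (h : IsGalerkinSolution L K hK F C T 0 ξ u y) {t : ℝ} (ht : 0 ≤ t)
    (hw : ∀ r ∈ Icc t T, w r = u (r - t)) :
    IsGalerkinSolution L K hK F C T t ξ w fun s => y (s - t) := by
  have hm : ∀ s ∈ Icc t T, s - t ∈ Icc 0 T := fun s hs =>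
    ⟨sub_nonneg.2 hs.1, by linarith [hs.2]⟩
  refine ⟨h.1.comp (by fun_prop) hm, fun s hs => ?_⟩
  have h1 := intervalIntegral.integral_comp_sub_right (a := t) (b := s)
    (fun r => galerkinOperator L K hK (y r) + K.starProjection (F (y r))
      + K.starProjection (C (u r))) t
  rw [sub_self] at h1
  have h4 := h.2 (s - t) (hm s hs)
  rw [← h1] at h4
  refine h4.trans (congrArg (ξ + ·) ?_)
  refine intervalIntegral.integral_congr fun r hr => ?_
  rw [uIcc_of_le hs.1] at hr
  simp only [hw r ⟨hr.1, hr.2.trans hs.2⟩]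

end Shift

section Controls

variable {V : Type*} [NormedAddCommGroup V] {q : ℝ≥0∞} {U : Set V} {T t : ℝ} {w : ℝ → V}

theorem aestronglyMeasurable_of_mem_admissibleControlsFrom (ht : 0 ≤ t)
    (hw : w ∈ admissibleControlsFrom q U T t) :
    AEStronglyMeasurable w (volume.restrict (Icc t T)) := by
  obtain ⟨u, hu, hwu⟩ := hw
  refine (hu.1.1.mono_measure (Measure.restrict_mono (Icc_subset_Icc_left ht) le_rfl)).congr ?_
  filter_upwards [ae_restrict_mem measurableSet_Icc] with r hr using (hwu hr).symm

theorem ae_mem_of_mem_admissibleControlsFrom (ht : 0 ≤ t)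
    (hw : w ∈ admissibleControlsFrom q U T t) :
    ∀ᵐ r ∂(volume.restrict (Icc t T)), w r ∈ U := by
  obtain ⟨u, hu, hwu⟩ := hw
  filter_upwards [ae_restrict_mem measurableSet_Icc,
    ae_restrict_of_ae_restrict_of_subset (Icc_subset_Icc_left ht) hu.2] with r hr hrU
  rwa [hwu hr]

/-- A control on `[t, T]`, moved to start at time `0`, extends to an admissible control. The
extension takes a constant value in `U`. -/
theorem exists_admissibleControls_comp_sub_right (hU : IsCompact U) (ht : 0 ≤ t) (htT : t < T)
    (hw : w ∈ admissibleControlsFrom q U T t) :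
    ∃ u ∈ admissibleControls q U T, ∀ r ∈ Icc t T, w r = u (r - t) := by
  have hwm := aestronglyMeasurable_of_mem_admissibleControlsFrom ht hw
  have hwU := ae_mem_of_mem_admissibleControlsFrom ht hw
  obtain ⟨u₀, hu₀⟩ : U.Nonempty := by
    have hne : volume.restrict (Icc t T) ≠ 0 := by
      rw [Ne, Measure.restrict_eq_zero, Real.volume_Icc, ENNReal.ofReal_eq_zero]
      linarith
    have : (ae (volume.restrict (Icc t T))).NeBot := ae_neBot.2 hne
    obtain ⟨r, hr⟩ := hwU.exists
    exact ⟨_, hr⟩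
  classical
  set e : ℝ → V := (Icc t T).piecewise w fun _ => u₀ with he
  have hem : AEStronglyMeasurable e volume :=
    AEStronglyMeasurable.piecewise measurableSet_Icc hwm aestronglyMeasurable_const
  have heU : ∀ᵐ r, e r ∈ U := by
    filter_upwards [(ae_restrict_iff' measurableSet_Icc).1 hwU] with r hr
    by_cases h : r ∈ Icc t T
    · rw [he, piecewise_eq_of_mem _ _ _ h]; exact hr h
    · rw [he, piecewise_eq_of_notMem _ _ _ h]; exact hu₀
  have hmp := measurePreserving_add_right (volume : Measure ℝ) t
  obtain ⟨B, hB⟩ := hU.isBounded.exists_norm_le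
  have hsU : ∀ᵐ r ∂(volume.restrict (Icc 0 T)), e (r + t) ∈ U :=
    ae_restrict_of_ae (hmp.quasiMeasurePreserving.ae heU)
  refine ⟨fun r => e (r + t), ⟨MemLp.of_bound ?_ B (hsU.mono fun r hr => hB _ hr), hsU⟩,
    fun r hr => ?_⟩
  · exact (hem.comp_quasiMeasurePreserving hmp.quasiMeasurePreserving).restrict
  · simp only [sub_add_cancel, he]
    rw [piecewise_eq_of_mem _ _ _ hr]

end Controls

/-! ### Value functions -/

section Value

variable {H V : Type*}

theorem cost_nonneg {G : H → ℝ} {E : V → ℝ} (hG : ∀ z, 0 ≤ G z) (hE : ∀ w, 0 ≤ E w) {T t : ℝ}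
    (ht : t ≤ T) (p : (ℝ → V) × (ℝ → H)) : 0 ≤ cost G E T t p :=
  intervalIntegral.integral_nonneg ht fun _ _ => add_nonneg (hG _) (hE _)

variable [NormedAddCommGroup V]

theorem valueFunction_le_add {q : ℝ≥0∞} {U : Set V} {G : H → ℝ} {E : V → ℝ}
    (hG : ∀ z, 0 ≤ G z) (hE : ∀ w, 0 ≤ E w) {T t : ℝ} (ht : t < T)
    {sol₁ sol₂ : ℝ → H → (ℝ → V) → (ℝ → H) → Prop} {x₁ x₂ : H} {η : ℝ}
    (hne : (admissiblePairs q U T sol₂ t x₂).Nonempty)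
    (h : ∀ p ∈ admissiblePairs q U T sol₂ t x₂, ∃ p' ∈ admissiblePairs q U T sol₁ t x₁,
      cost G E T t p' ≤ cost G E T t p + η) :
    valueFunction q U G E T sol₁ t x₁ ≤ valueFunction q U G E T sol₂ t x₂ + η := by
  simp only [valueFunction, if_pos ht]
  rw [← sub_le_iff_le_add]
  refine le_csInf (hne.image _) ?_
  rintro _ ⟨p, hp, rfl⟩
  obtain ⟨p', hp', hle⟩ := h p hp
  rw [sub_le_iff_le_add]
  refine (csInf_le ⟨0, ?_⟩ (mem_image_of_mem _ hp')).trans hle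
  rintro _ ⟨p, -, rfl⟩
  exact cost_nonneg hG hE ht.le p

theorem abs_cost_sub_cost_le [NormedAddCommGroup H] {G : H → ℝ} {E : V → ℝ} (hG : Continuous G)
    (hE : Continuous E) {U : Set V} (hU : IsCompact U) {T t : ℝ} (ht : t ≤ T) {w : ℝ → V}
    (hw : AEStronglyMeasurable w (volume.restrict (Icc t T)))
    (hwU : ∀ᵐ r ∂(volume.restrict (Icc t T)), w r ∈ U) {y₁ y₂ : ℝ → H}
    (h₁ : ContinuousOn y₁ (Icc t T)) (h₂ : ContinuousOn y₂ (Icc t T)) {η : ℝ}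
    (hη : ∀ s ∈ Icc t T, ‖G (y₁ s) - G (y₂ s)‖ ≤ η) :
    |cost G E T t (w, y₁) - cost G E T t (w, y₂)| ≤ η * (T - t) := by
  obtain ⟨B, hB⟩ := (hU.image hE).isBounded.exists_norm_le
  have hEi : IntervalIntegrable (fun s => E (w s)) volume t T := by
    rw [intervalIntegrable_iff_integrableOn_Icc_of_le ht]
    exact Integrable.mono' (integrable_const B) (hE.comp_aestronglyMeasurable hw)
      (hwU.mono fun r hr => hB _ (mem_image_of_mem _ hr))
  have hGi : ∀ {y : ℝ → H}, ContinuousOn y (Icc t T) →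
      IntervalIntegrable (fun s => G (y s)) volume t T := fun hy =>
    ContinuousOn.intervalIntegrable (by rw [uIcc_of_le ht]; exact hG.comp_continuousOn hy)
  rw [cost, cost, ← intervalIntegral.integral_sub ((hGi h₁).add hEi) ((hGi h₂).add hEi),
    ← Real.norm_eq_abs, ← abs_of_nonneg (sub_nonneg.2 ht)]
  refine intervalIntegral.norm_integral_le_of_norm_le_const fun s hs => ?_
  rw [uIoc_of_le ht] at hs
  simp only [add_sub_add_right_eq_sub]
  exact hη s (Ioc_subset_Icc_self hs)

end Value

end GalerkinControl

/-! ### Convergence of the value functions -/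

theorem mainTheorem1
    {H V : Type*}
    [NormedAddCommGroup H] [InnerProductSpace ℝ H] [CompleteSpace H]
    [TopologicalSpace.SeparableSpace H]
    [NormedAddCommGroup V] [InnerProductSpace ℝ V] [CompleteSpace V]
    [TopologicalSpace.SeparableSpace V]
    -- the linear operator generates a `C₀`-semigroup
    (L : H →ₗ.[ℝ] H) (S : ℝ → H →L[ℝ] H)
    (hS : IsC0Semigroup S) (hLS : IsInfinitesimalGenerator L S)
    -- the Galerkin subspaces
    (K : ℕ → Submodule ℝ H) [∀ N, FiniteDimensional ℝ (K N)]
    (hKL : ∀ N, K N ≤ L.domain)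
    (hK : ∀ x : H, Tendsto (fun N => ‖(K N).starProjection x - x‖) atTop (𝓝 0))
    -- stability
    (M ω : ℝ) (hM : 1 ≤ M) (hω : 0 ≤ ω)
    (hSbound : ∀ t : ℝ, 0 ≤ t → ‖S t‖ ≤ M * Real.exp (ω * t))
    (hstab : ∀ N, ∃ TN : ℝ → H →L[ℝ] H, IsC0Semigroup TN ∧
      (∀ t : ℝ, 0 ≤ t → ∀ z ∈ K N,
        TN t z = NormedSpace.exp (t • galerkinOperator L (K N) (hKL N)) z) ∧
      ∀ t : ℝ, 0 ≤ t → ‖TN t‖ ≤ M * Real.exp (ω * t))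
    -- consistency
    (hcons : ∀ φ : L.domain,
      Tendsto (fun N => ‖galerkinOperator L (K N) (hKL N) (φ : H) - L φ‖) atTop (𝓝 0))
    -- the nonlinearity and the control operator
    (F : H → H) (hF : LipschitzOnBalls F)
    (C : V → H) (hC : Continuous C) (hC0 : C 0 = 0)
    -- the admissible controls
    (T : ℝ) (hT : 0 < T) (q : ℝ≥0∞) (hq : 1 ≤ q) (hq' : q ≠ ∞)
    (U : Set V) (hU : IsCompact U) (hUconv : Convex ℝ U)
    -- well-posedness of the state equation and of its Galerkin approximations
    (hwp : ∀ x : H, ∀ u ∈ admissibleControls q U T,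
      (∃ y, IsMildSolution S F C T 0 x u y) ∧
      (∀ y y', IsMildSolution S F C T 0 x u y → IsMildSolution S F C T 0 x u y' →
        EqOn y y' (Icc 0 T)))
    (hwpN : ∀ x : H, ∀ u ∈ admissibleControls q U T, ∀ N,
      (∃ y, IsGalerkinSolution L (K N) (hKL N) F C T 0 ((K N).starProjection x) u y) ∧
      (∀ y y', IsGalerkinSolution L (K N) (hKL N) F C T 0 ((K N).starProjection x) u y →
        IsGalerkinSolution L (K N) (hKL N) F C T 0 ((K N).starProjection x) u y' →
        EqOn y y' (Icc 0 T)))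
    -- bounds that are uniform in the control
    (hbound : ∀ x : H, ∃ R : ℝ, ∀ u ∈ admissibleControls q U T,
      (∀ y, IsMildSolution S F C T 0 x u y → ∀ t ∈ Icc 0 T, ‖y t‖ ≤ R) ∧
      (∀ N, ∀ y, IsGalerkinSolution L (K N) (hKL N) F C T 0 ((K N).starProjection x) u y →
        ∀ t ∈ Icc 0 T, ‖y t‖ ≤ R))
    -- the residual energy vanishes uniformly in the control and in time
    (hres : ∀ x : H, Tendsto
      (fun N => ⨆ u ∈ admissibleControls q U T, ⨆ y ∈ {y | IsMildSolution S F C T 0 x u y},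
        ⨆ t ∈ Icc 0 T, ‖y t - (K N).starProjection (y t)‖ₑ) atTop (𝓝 0))
    -- the running costs
    (G : H → ℝ) (hG0 : ∀ z, 0 ≤ G z) (hG : LipschitzOnBalls G)
    (E : V → ℝ) (hE0 : ∀ w, 0 ≤ E w) (hE : Continuous E)
    -- existence of minimizers
    (hmin : ∀ t ∈ Ico 0 T, ∀ x : H,
      HasMinimizer q U G E T (IsMildSolution S F C T) t x)
    (hminN : ∀ N, ∀ t ∈ Ico 0 T, ∀ ξ ∈ K N,
      HasMinimizer q U G E T (IsGalerkinSolution L (K N) (hKL N) F C T) t ξ) :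
    ∀ x : H, Tendsto
      (fun N => ⨆ t ∈ Icc 0 T,
        ‖valueFunction q U G E T (IsGalerkinSolution L (K N) (hKL N) F C T) t
            ((K N).starProjection x)
          - valueFunction q U G E T (IsMildSolution S F C T) t x‖ₑ)
      atTop (𝓝 0) := by
  intro x
  have hWb : ∀ N, ∀ t : ℝ, 0 ≤ t →
      ‖galerkinSemigroup L (K N) (hKL N) t‖ ≤ M * Real.exp (ω * t) := fun N t ht => by
    obtain ⟨TN, -, h1, h2⟩ := hstab N
    exact norm_galerkinSemigroup_le L (K N) (hKL N) hM h1 h2 ht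
  obtain ⟨R, hR⟩ := hbound x
  obtain ⟨k, hk₀, hk⟩ := hG (|R| + 1) (by positivity)
  rw [ENNReal.tendsto_nhds_zero]
  intro ε hε
  obtain ⟨η, hη₀, hη⟩ : ∃ η : ℝ, 0 < η ∧ ENNReal.ofReal η ≤ ε := by
    rcases eq_or_ne ε ∞ with rfl | h
    · exact ⟨1, one_pos, le_top⟩
    · exact ⟨ε.toReal, ENNReal.toReal_pos hε.ne' h, ENNReal.ofReal_toReal_le⟩
  have hδ : 0 < η / (k * T) := by positivity
  filter_upwards [eventually_norm_isGalerkinSolution_sub_isMildSolution_le hS hLS hK hM hω hSbound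
    hWb hcons hF hC hT hU hR (hres x) hδ] with N hN
  refine le_trans (iSup₂_le fun t ht => ?_) hη
  rw [← ofReal_norm]
  refine ENNReal.ofReal_le_ofReal ?_
  rcases ht.2.lt_or_eq with htT | rfl
  swap
  · simp [valueFunction, hη₀.le]
  -- every control on `[t, T]` has a state for each equation, and these are close
  have key : ∀ w ∈ admissibleControlsFrom q U T t, ∃ y y',
      IsGalerkinSolution L (K N) (hKL N) F C T t ((K N).starProjection x) w y ∧
      IsMildSolution S F C T t x w y' ∧
      ∀ s ∈ Icc t T, ‖G (y s) - G (y' s)‖ ≤ η / T := by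
    intro w hw
    obtain ⟨u, hu, hwu⟩ := exists_admissibleControls_comp_sub_right hU ht.1 htT hw
    obtain ⟨y, hy⟩ := (hwpN x u hu N).1
    obtain ⟨y', hy'⟩ := (hwp x u hu).1
    refine ⟨_, _, hy.comp_sub_right ht.1 hwu, hy'.comp_sub_right ht.1 hwu, fun s hs => ?_⟩
    have hst : s - t ∈ Icc 0 T := ⟨sub_nonneg.2 hs.1, by linarith [hs.2, ht.1]⟩
    have hle : R ≤ |R| + 1 := by linarith [le_abs_self R]
    refine (hk _ (mem_closedBall_zero_iff.2 (((hR u hu).2 N y hy _ hst).trans hle)) _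
      (mem_closedBall_zero_iff.2 (((hR u hu).1 y' hy' _ hst).trans hle))).trans ?_
    refine (mul_le_mul_of_nonneg_left (hN u hu y y' hy hy' _ hst) hk₀.le).trans_eq ?_
    field_simp
  have hηT : η / T * (T - t) ≤ η := by
    rw [div_mul_eq_mul_div, div_le_iff₀ hT]
    exact mul_le_mul_of_nonneg_left (by linarith [ht.1]) hη₀.le
  have hclose : ∀ w ∈ admissibleControlsFrom q U T t, ∀ y y',
      IsGalerkinSolution L (K N) (hKL N) F C T t ((K N).starProjection x) w y →
      IsMildSolution S F C T t x w y' →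
      |cost G E T t (w, y) - cost G E T t (w, y')| ≤ η := by
    intro w hw y y' hy hy'
    have hwm := aestronglyMeasurable_of_mem_admissibleControlsFrom ht.1 hw
    have hwU := ae_mem_of_mem_admissibleControlsFrom ht.1 hw
    obtain ⟨z, z', hz, hz', hzz⟩ := key w hw
    obtain ⟨c, hc⟩ := (isCompact_Icc (a := (0 : ℝ)) (b := T - t)).exists_bound_of_continuousOn
      (continuous_galerkinSemigroup L (K N) (hKL N)).continuousOn
    have e : EqOn y z (Icc t T) := IsMildSolution.eqOn
      (((continuous_galerkinSemigroup L (K N) (hKL N)).comp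
        (continuous_fst.max continuous_const)).clm_apply continuous_snd) hF hC hU hwm hwU hc
      (hy.isMildSolution hF.continuous hC hU hwm hwU)
      (hz.isMildSolution hF.continuous hC hU hwm hwU)
    have e' : EqOn y' z' (Icc t T) := hy'.eqOn (hS.continuous_apply hM hω hSbound) hF hC hU hwm hwU
      (fun r hr => (hSbound r hr.1).trans (mul_exp_le_mul_exp hM hω hr.2)) hz'
    refine (abs_cost_sub_cost_le hG.continuous hE hU htT.le hwm hwU hy.1 hy'.1
      fun s hs => ?_).trans hηT
    rw [e hs, e' hs]
    exact hzz s hs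
  have hmem : t ∈ Ico 0 T := ⟨ht.1, htT⟩
  rw [Real.norm_eq_abs, abs_sub_le_iff, sub_le_iff_le_add', sub_le_iff_le_add']
  constructor
  · obtain ⟨p, hp, -⟩ := hmin t hmem x
    refine valueFunction_le_add hG0 hE0 htT ⟨p, hp⟩ ?_
    rintro ⟨w, y'⟩ ⟨hw, hy'⟩
    obtain ⟨y, -, hy, -, -⟩ := key w hw
    refine ⟨(w, y), ⟨hw, hy⟩, ?_⟩
    linarith [(abs_le.1 (hclose w hw y y' hy hy')).2]
  · obtain ⟨p, hp, -⟩ := hminN N t hmem _ ((K N).starProjection_apply_mem x)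
    refine valueFunction_le_add hG0 hE0 htT ⟨p, hp⟩ ?_
    rintro ⟨w, y⟩ ⟨hw, hy⟩
    obtain ⟨-, y', -, hy', -⟩ := key w hw
    refine ⟨(w, y'), ⟨hw, hy'⟩, ?_⟩
    linarith [(abs_le.1 (hclose w hw y y' hy hy')).1]
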